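/- Let $M\subset\mathbb R^3$ be a regular $C^\infty$ surface oriented by a unit normal field $N$, with shape operator $-dN$, and let $c:[0,l]\to M$ be a smooth curve of umbilic points of $M$, parametrized by arc length $u$, with $T=c'$. Let $u_0\in(0,l)$, let $k(u)$ be the normal curvature of $M$ at $c(u)$ in the direction $T(u)$, and let $\mathcal H$ be the mean curvature of $M$ (half the trace of $-dN$). Near $c(u_0)$ the surface has a local $C^\infty$ chart of the form $$\alpha(u,v)=c(u)+v\,(N\wedge T)(u)+h(u,v)\,N(u),\qquad h(u,v)=\tfrac12k(u)v^2+\tfrac16a(u)v^3+O(v^4),$$ which defines the function $a(u)=\partial_v^3h(u,0)$, and, writing $\mathcal H(u,v)=\mathcal H(\alpha(u,v))$, $$\nabla\mathcal H(u_0,0)=\bigl(k'(u_0),\,a(u_0)/2\bigr).$$ Suppose that $\nabla\mathcal H(u_0,0)\ne0$. Then $c(u_0)$ has a neighbourhood in $M$ whose only umbilic points are the points of $c$, and on which there are two mutually orthogonal smooth line fields consisting of principal directions: they are the two principal directions at each non-umbilic point and extend these smoothly across $c$. The foliations they define are called the principal foliations near $c(u_0)$, and they satisfy: (i) If $k'(u_0)\neq0$,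 then both principal foliations are transversal to the curve $c$ near $c(u_0)$. (ii) If $k'(u_0)=0$, $k''(u_0)\ne0$ and $a(u_0)\neq0$, then one principal foliation is transversal to $c$ near $c(u_0)$, and the leaf of the other through $c(u_0)$ has quadratic contact with $c$ at $c(u_0)$; that is, it is tangent to $c$ there, but no regular reparametrization makes it agree with $c$ to second order at that point. -/

import Mathlib

open Set Filter Topology Asymptotics
open scoped ContDiff

noncomputable section

namespace UmbilicCurve

/-- Euclidean three-space. -/
abbrev E3 : Type := EuclideanSpace ℝ (Fin 3)

/-- The vector product `x ∧ y` of `ℝ³`. -/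
def wedge (x y : E3) : E3 := WithLp.toLp 2 (crossProduct x.ofLp y.ofLp)

/-- `M` is a regular `C^∞` surface in `ℝ³` oriented by the unit normal field `N`.
Near each of its points `M` is a regular level set `F = 0` of a smooth function, whose gradient
is a nonzero multiple of `N` along `M`; so the tangent plane at `p` is the orthogonal
complement of `N p`. The field `N` is the restriction to `M` of a map that is smooth on an open
neighbourhood of `M`; only its values on `M` matter below. -/
structure IsOrientedSurface (M : Set E3) (N : E3 → E3) : Prop where
  regular : ∀ p ∈ M, ∃ (V : Set E3) (F : E3 → ℝ), IsOpen V ∧ p ∈ V ∧ ContDiffOn ℝ ∞ F V ∧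
    (∀ q ∈ V, q ∈ M ↔ F q = 0) ∧
    ∀ q ∈ M ∩ V, ∃ μ : ℝ, μ ≠ 0 ∧ ∀ w : E3, fderiv ℝ F q w = μ * inner ℝ (N q) w
  smooth_normal : ∃ W : Set E3, IsOpen W ∧ M ⊆ W ∧ ContDiffOn ℝ ∞ N W
  unit_normal : ∀ p ∈ M, ‖N p‖ = 1

/-- The shape operator `-dN` at `p`, extended to `ℝ³` by first projecting orthogonally onto the
tangent plane; it vanishes on `N p`. -/
def shapeOperator (N : E3 → E3) (p : E3) : E3 →L[ℝ] E3 :=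
  -(fderiv ℝ N p ∘L (ContinuousLinearMap.id ℝ E3 - (innerSL ℝ (N p)).smulRight (N p)))

/-- The mean curvature, half of the trace of the shape operator. -/
def meanCurvature (N : E3 → E3) (p : E3) : ℝ :=
  (1 / 2) * LinearMap.trace ℝ E3 (shapeOperator N p : E3 →ₗ[ℝ] E3)

/-- The normal curvature at `p` in the direction of a unit tangent vector `w`. -/
def normalCurvature (N : E3 → E3) (p w : E3) : ℝ := inner ℝ (shapeOperator N p w) w

/-- `p` is umbilic: the shape operator is a multiple of the identity on the tangent plane. -/
def IsUmbilic (N : E3 → E3) (p : E3) : Prop :=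
  ∃ κ : ℝ, ∀ w : E3, inner ℝ (N p) w = 0 → shapeOperator N p w = κ • w

/-- `w` spans a principal direction at `p`. -/
def IsPrincipalVector (N : E3 → E3) (p w : E3) : Prop :=
  w ≠ 0 ∧ inner ℝ (N p) w = 0 ∧ ∃ κ : ℝ, shapeOperator N p w = κ • w

/-- `c : [0,l] → M` is a smooth curve of umbilic points, parametrized by arc length. -/
structure IsUmbilicCurve (M : Set E3) (N : E3 → E3) (l : ℝ) (c : ℝ → E3) : Prop where
  smooth : ContDiffOn ℝ ∞ c (Icc 0 l)
  unit_speed : ∀ u ∈ Ioo 0 l, ‖deriv c u‖ = 1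
  mem : ∀ u ∈ Icc 0 l, c u ∈ M
  umbilic : ∀ u ∈ Icc 0 l, IsUmbilic N (c u)

/-- The normal curvature `k(u)` of the surface at `c u` in the direction `T = c'`. -/
def curvatureAlong (N : E3 → E3) (c : ℝ → E3) (u : ℝ) : ℝ :=
  normalCurvature N (c u) (deriv c u)

/-- The map `α(u,v) = c(u) + v (N ∧ T)(u) + h(u,v) N(u)`. -/
def stripChart (N : E3 → E3) (c : ℝ → E3) (h : ℝ × ℝ → ℝ) (q : ℝ × ℝ) : E3 :=
  c q.1 + q.2 • wedge (N (c q.1)) (deriv c q.1) + h q • N (c q.1)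

/-- `α(u,v) = c(u) + v (N ∧ T)(u) + h(u,v) N(u)` is a smooth local chart of `M` near
`α(u₀,0) = c(u₀)`, and `h(u,v) = k(u) v²/2 + O(v³)`. The equality of filters says that `α` maps
the neighbourhoods of `(u₀,0)` onto the neighbourhoods of `c u₀` in `M`. -/
structure IsStripHeight (M : Set E3) (N : E3 → E3) (c : ℝ → E3) (u₀ : ℝ) (h : ℝ × ℝ → ℝ) :
    Prop where
  smooth : ∃ U : Set (ℝ × ℝ), IsOpen U ∧ (u₀, 0) ∈ U ∧ ContDiffOn ℝ ∞ h U
  chart : map (stripChart N c h) (𝓝 (u₀, 0)) = 𝓝[M] (c u₀)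
  zero : ∀ᶠ u in 𝓝 u₀, h (u, 0) = 0
  one : ∀ᶠ u in 𝓝 u₀, deriv (fun v => h (u, v)) 0 = 0
  two : ∀ᶠ u in 𝓝 u₀, iteratedDeriv 2 (fun v => h (u, v)) 0 = curvatureAlong N c u

/-- The coefficient `a(u)` in `h(u,v) = k(u) v²/2 + a(u) v³/6 + b(u) v⁴/24 + ⋯`. -/
def cubicCoeff (h : ℝ × ℝ → ℝ) (u : ℝ) : ℝ := iteratedDeriv 3 (fun v => h (u, v)) 0

/-- The two principal foliations on `M ∩ V`, as a pair of orthogonal smooth line fields, spanned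
by `X₁` and `X₂`, which are principal at every point. At the points that are not umbilic the two
lines are therefore the two principal directions; where the other points are limits of these, the
lines there are the continuous extensions. -/
structure IsPrincipalPair (M : Set E3) (N : E3 → E3) (V : Set E3) (X₁ X₂ : E3 → E3) : Prop where
  smooth₁ : ContDiffOn ℝ ∞ X₁ V
  smooth₂ : ContDiffOn ℝ ∞ X₂ V
  principal₁ : ∀ p ∈ M ∩ V, IsPrincipalVector N p (X₁ p)
  principal₂ : ∀ p ∈ M ∩ V, IsPrincipalVector N p (X₂ p)
  orthogonal : ∀ p ∈ M ∩ V, inner ℝ (X₁ p) (X₂ p) = 0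

/-- The foliation spanned by `X` is transversal to the curve `c` near `c u₀`. -/
def IsTransversalNear (X : E3 → E3) (c : ℝ → E3) (u₀ : ℝ) : Prop :=
  ∀ᶠ u in 𝓝 u₀, LinearIndependent ℝ ![X (c u), deriv c u]

/-- `γ` parametrizes, near time `0`, the leaf through `p` of the foliation of `M` spanned
by `X`: a regular smooth curve in `M`, everywhere tangent to `X`. -/
def IsLeafAt (M : Set E3) (X : E3 → E3) (p : E3) (γ : ℝ → E3) : Prop :=
  γ 0 = p ∧ ∃ ε > 0, ContDiffOn ℝ ∞ γ (Ioo (-ε) ε) ∧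
    ∀ t ∈ Ioo (-ε) ε, γ t ∈ M ∧ deriv γ t ≠ 0 ∧ deriv γ t ∈ Submodule.span ℝ {X (γ t)}

/-- The regular curves `γ` at `t₀` and `δ` at `s₀` have contact of order at least `n`: after a
smooth regular change of parameter they agree up to an error `o((t - t₀)^n)`. -/
def HasContact (n : ℕ) (γ : ℝ → E3) (t₀ : ℝ) (δ : ℝ → E3) (s₀ : ℝ) : Prop :=
  ∃ φ : ℝ → ℝ, ContDiffAt ℝ ∞ φ t₀ ∧ φ t₀ = s₀ ∧ deriv φ t₀ ≠ 0 ∧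
    (fun t => γ t - δ (φ t)) =o[𝓝 t₀] fun t => (t - t₀) ^ n

/-- Quadratic contact: the curves are tangent, and do not agree to second order. -/
def HasQuadraticContact (γ : ℝ → E3) (t₀ : ℝ) (δ : ℝ → E3) (s₀ : ℝ) : Prop :=
  HasContact 1 γ t₀ δ s₀ ∧ ¬ HasContact 2 γ t₀ δ s₀

/-- The leaf through `c u₀` of the foliation of `M` spanned by `X` exists and has quadratic
contact with `c` there. -/
def LeafHasQuadraticContact (M : Set E3) (X : E3 → E3) (c : ℝ → E3) (u₀ : ℝ) : Prop :=
  (∃ γ, IsLeafAt M X (c u₀) γ) ∧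
    ∀ γ, IsLeafAt M X (c u₀) γ → HasQuadraticContact γ 0 c u₀

end UmbilicCurve

end

/-! Write `T = c'`, `B = N ∧ T`, and let `S` be the shape operator along the chart `α`. On the axis
`v = 0` every point is umbilic, so `S` acts on the tangent plane as `k(u)`. Differentiating `S B = k
B` in `u` gives `S_u B = k' B`, because `B'` is again tangent. Codazzi turns this into `S_v T = k'
B`. Differentiating `⟨S α_v, α_v⟩ = h_vv ⟨N, N(c)⟩` in `v` gives `⟨S_v B, B⟩ = a`. Half the trace
then yields the gradient `(k', a/2)` of the mean curvature.

In an orthonormal tangent frame `(e, f)` extending `(T, B)`, the functions `⟨Se,e⟩ - ⟨Sf,f⟩` and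
`⟨Se,f⟩` vanish for `v = 0`. By Hadamard's lemma they are `v p` and `v r` with `p`, `r` smooth, and
the formulas above give `p(u,0) = -a(u)` and `r(u,0) = k'(u)`. The traceless part of `S` is
therefore `v` times the matrix `[[p/2, r], [r, -p/2]]`, which is nonzero at `(u₀,0)` exactly when
the gradient is. So nearby umbilics lie on `v = 0`, and the eigenlines of the divided matrix are
smooth across the axis. If `(x, y)` spans one, `(-y, x)` spans the other, and eliminating the
eigenvalue gives `p x y = r (x² - y²)`.

On the axis, `y` is the conormal component of the first field and `x` that of the second. If `k' ≠
0` the relation forbids `x = 0` and `y = 0`: both fields are transversal. If `k' = 0` then `p ≠ 0`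
and `x y = 0`, so one field is tangent to `c`. Differentiating the relation along `c` shows that the
conormal component of that field has nonzero derivative when `k'' ≠ 0`. Hence the coordinate `v`
along its leaf vanishes to first order but not to second, whereas `v = 0` on every reparametrization
of `c`. This is quadratic contact.

The carrying lemmas are `IsStrip.fderiv_shape_snd_tangent`,
`IsStrip.inner_fderiv_shape_snd_conormal`, `IsFrame.exists_coefficients`,
`exists_smooth_eigenvector` and `IsCoord.leafHasQuadraticContact`. -/

namespace UmbilicCurve

/-! ### Analytic tools: division by a coordinate, local inverses, integral curves. -/

/-- **Hadamard's lemma**, global form. -/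
theorem exists_contDiff_eq_snd_mul_of_contDiff {f : ℝ × ℝ → ℝ} (hf : ContDiff ℝ ∞ f)
    (h0 : ∀ u, f (u, 0) = 0) :
    ∃ g : ℝ × ℝ → ℝ, ContDiff ℝ ∞ g ∧ ∀ q, f q = q.2 * g q := by
  let χ : ContDiffBump (0 : ℝ) := ⟨2, 3, by norm_num, by norm_num⟩
  let φ : ℝ × ℝ → ℝ := fun q => fderiv ℝ f q (0, 1)
  have hφ : ContDiff ℝ ∞ φ := (hf.fderiv_right (m := ∞) (by simp)).clm_apply contDiff_const
  -- The quotient is `∫₀¹ ∂_v f(u, t v) dt`, written as the convolution at `0` of the indicator of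
  -- `[0,1]` with `G q`, so that smoothness in the parameter `q` follows. Convolution evaluates `G
  -- q` at `-t`, whence the sign; the bump is `1` there and only supplies compact support.
  let G : ℝ × ℝ → ℝ → ℝ := fun q x => χ x * φ (q.1, -(x * q.2))
  have hG : ContDiff ℝ ∞ (fun z : (ℝ × ℝ) × ℝ => G z.1 z.2) := by
    refine ContDiff.mul (χ.contDiff.comp contDiff_snd) (hφ.comp ?_)
    fun_prop
  have key := MeasureTheory.contDiffOn_convolution_right_with_param_comp (𝕜 := ℝ) (n := ⊤)
    (μ := MeasureTheory.volume)
    (ContinuousLinearMap.mul ℝ ℝ) (s := (univ : Set (ℝ × ℝ))) (v := fun _ => (0 : ℝ))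
    contDiffOn_const (f := (Icc (0 : ℝ) 1).indicator (fun _ => (1 : ℝ))) (g := G)
    (k := Metric.closedBall 0 3) isOpen_univ (isCompact_closedBall _ _)
    (by
      intro p x _ hx
      have : χ x = 0 := χ.zero_of_le_dist (by
        rw [Metric.mem_closedBall, not_le] at hx
        exact hx.le)
      simp [G, this])
    ((MeasureTheory.integrable_indicator_iff measurableSet_Icc).2
      (by simp [MeasureTheory.IntegrableOn])).locallyIntegrable
    (by exact hG.contDiffOn)
  refine ⟨_, contDiffOn_univ.1 key, ?_⟩
  rintro ⟨u, v⟩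
  have h1 : MeasureTheory.convolution ((Icc (0 : ℝ) 1).indicator (fun _ => (1 : ℝ))) (G (u, v))
      (ContinuousLinearMap.mul ℝ ℝ) MeasureTheory.volume 0 = ∫ t in (0 : ℝ)..1, φ (u, t * v) := by
    rw [MeasureTheory.convolution_def, intervalIntegral.integral_of_le zero_le_one,
      ← MeasureTheory.integral_Icc_eq_integral_Ioc,
      ← MeasureTheory.integral_indicator measurableSet_Icc]
    congr 1
    ext t
    by_cases ht : t ∈ Icc (0 : ℝ) 1
    · have : χ (-t) = 1 := χ.one_of_mem_closedBall (by
        simp only [Metric.mem_closedBall, dist_zero_right, norm_neg, Real.norm_eq_abs]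
        rw [abs_of_nonneg ht.1]
        change t ≤ 2
        linarith [ht.2])
      simp [ht, G, this]
    · simp [ht]
  rw [h1, mul_comm]
  change f (u, v) = _
  rw [← intervalIntegral.integral_mul_const]
  have h2 : ∀ t : ℝ, HasDerivAt (fun s : ℝ => f (u, s * v)) (φ (u, t * v) * v) t := by
    intro t
    have hd : HasDerivAt (fun s : ℝ => (u, s * v)) ((0 : ℝ), v) t := by
      simpa using (hasDerivAt_const t u).prodMk ((hasDerivAt_id t).mul_const v)
    have := ((hf.differentiable (by simp)) (u, t * v)).hasFDerivAt.comp_hasDerivAt t hd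
    have h3 : ((0 : ℝ), v) = v • ((0 : ℝ), (1 : ℝ)) := by simp
    rw [h3, map_smul, smul_eq_mul, mul_comm] at this
    exact this
  rw [intervalIntegral.integral_eq_sub_of_hasDerivAt (fun t _ => h2 t)]
  · simp [h0]
  · exact Continuous.intervalIntegrable
      ((hφ.continuous.comp (by fun_prop)).mul continuous_const) _ _

/-- **Hadamard's lemma**, local form. -/
theorem exists_contDiff_eq_snd_mul {f : ℝ × ℝ → ℝ} {U : Set (ℝ × ℝ)} (hU : IsOpen U)
    {q : ℝ × ℝ} (hq : q ∈ U) (hf : ContDiffOn ℝ ∞ f U) (h0 : ∀ u, (u, 0) ∈ U → f (u, 0) = 0) :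
    ∃ g : ℝ × ℝ → ℝ, ContDiff ℝ ∞ g ∧ ∀ᶠ x in 𝓝 q, f x = x.2 * g x := by
  obtain ⟨χ, hχU, -, hχ, -, hχ1⟩ : ∃ χ : ℝ × ℝ → ℝ, tsupport χ ⊆ U ∧ HasCompactSupport χ ∧
      ContDiff ℝ ∞ χ ∧ range χ ⊆ Icc 0 1 ∧ χ =ᶠ[𝓝 q] 1 := by
    obtain ⟨r, hr, hrU⟩ := Metric.isOpen_iff.1 hU q hq
    let χ : ContDiffBump q := ⟨r / 3, r / 2, by positivity, by linarith⟩
    refine ⟨χ, ?_, χ.hasCompactSupport, χ.contDiff, ?_, χ.eventuallyEq_one⟩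
    · rw [χ.tsupport_eq]
      exact (Metric.closedBall_subset_ball (by change r / 2 < r; linarith)).trans hrU
    · rintro _ ⟨x, rfl⟩
      exact ⟨χ.nonneg, χ.le_one⟩
  -- The cutoff makes the function smooth on the whole plane, so the global form applies.
  have hsm : ContDiff ℝ ∞ (fun x => χ x * f x) := by
    rw [contDiff_iff_contDiffAt]
    intro x
    by_cases hx : x ∈ U
    · exact hχ.contDiffAt.mul (hf.contDiffAt (hU.mem_nhds hx))
    · have : (fun x => χ x * f x) =ᶠ[𝓝 x] fun _ => 0 := by
        filter_upwards [(isClosed_tsupport χ).isOpen_compl.mem_nhds (fun h => hx (hχU h))] with y hy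
        rw [image_eq_zero_of_notMem_tsupport hy, zero_mul]
      exact contDiffAt_const.congr_of_eventuallyEq this
  obtain ⟨g, hg, hfg⟩ := exists_contDiff_eq_snd_mul_of_contDiff hsm (fun u => by
    by_cases hx : (u, (0 : ℝ)) ∈ U
    · simp [h0 u hx]
    · simp [image_eq_zero_of_notMem_tsupport (fun h => hx (hχU h))])
  refine ⟨g, hg, ?_⟩
  filter_upwards [hχ1] with x hx
  rw [← hfg x, hx]
  simp

/-- The inverse function theorem for maps that are smooth on an open set, with an inverse that is
smooth on an open set. -/
theorem exists_smooth_local_inverse {E F : Type*} [NormedAddCommGroup E] [NormedSpace ℝ E]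
    [CompleteSpace E] [NormedAddCommGroup F] [NormedSpace ℝ F]
    {f : E → F} {a : E} {U : Set E} (hU : IsOpen U) (ha : a ∈ U) (hf : ContDiffOn ℝ ∞ f U)
    (f' : E ≃L[ℝ] F) (hf' : HasFDerivAt f (f' : E →L[ℝ] F) a) :
    ∃ e : OpenPartialHomeomorph E F, a ∈ e.source ∧ e.source ⊆ U ∧ (∀ x, e x = f x) ∧
      ContDiffOn ℝ ∞ e.symm e.target := by
  have hfa := hf.contDiffAt (hU.mem_nhds ha)
  let e₀ := hfa.toOpenPartialHomeomorph f hf' (by simp)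
  -- Restricting to points with invertible derivative, an open condition, makes the inverse smooth
  -- on its whole target and not just at the image of `a`.
  have hopen : IsOpen (U ∩ fderiv ℝ f ⁻¹' range ((↑) : (E ≃L[ℝ] F) → E →L[ℝ] F)) :=
    (hf.continuousOn_fderiv_of_isOpen hU (by simp)).isOpen_inter_preimage hU
      ContinuousLinearEquiv.isOpen
  refine ⟨e₀.restrOpen _ hopen, ⟨hfa.mem_toOpenPartialHomeomorph_source hf' (by simp), ha,
    ⟨f', hf'.fderiv.symm⟩⟩, fun x hx => hx.2.1, fun x => rfl, ?_⟩
  intro y hy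
  set e := e₀.restrOpen _ hopen with he
  have hs : e.symm y ∈ e.source := e.map_target hy
  obtain ⟨g, hg⟩ := hs.2.2
  have hc := hf.contDiffAt (hU.mem_nhds hs.2.1)
  have hd : HasFDerivAt e (g : E →L[ℝ] F) (e.symm y) := by
    rw [hg]
    exact (hc.differentiableAt (by simp)).hasFDerivAt
  exact (e.contDiffAt_symm hy hd hc).contDiffWithinAt

/-- Smooth vector fields have smooth integral curves. -/
theorem exists_smooth_integral_curve {E : Type*} [NormedAddCommGroup E] [NormedSpace ℝ E]
    [CompleteSpace E] {f : E → E} {U : Set E} (hU : IsOpen U) (hf : ContDiffOn ℝ ∞ f U) {x : E}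
    (hx : x ∈ U) :
    ∃ η : ℝ → E, η 0 = x ∧ ∃ ε > 0, ContDiffOn ℝ ∞ η (Ioo (-ε) ε) ∧
      ∀ t ∈ Ioo (-ε) ε, η t ∈ U ∧ HasDerivAt η (f (η t)) t := by
  have hc : ContDiffAt ℝ 1 f x := (hf.contDiffAt (hU.mem_nhds hx)).of_le (by simp)
  obtain ⟨η, h0, ε, hε, hη⟩ := hc.exists_forall_mem_closedBall_exists_eq_forall_mem_Ioo_hasDerivAt₀ 0
  rw [zero_sub, zero_add] at hη
  have hcont : ContinuousAt η 0 := (hη 0 ⟨by linarith, hε⟩).continuousAt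
  have hmem : ∀ᶠ t in 𝓝 (0 : ℝ), η t ∈ U := hcont (by rw [h0]; exact hU.mem_nhds hx)
  obtain ⟨δ, hδ, hδU⟩ := Metric.eventually_nhds_iff_ball.1 hmem
  -- A strictly smaller radius keeps the solution in `U` on the closed interval, where the
  -- regularity theorem for ODEs upgrades it to a smooth curve.
  obtain ⟨r, hr, hrm⟩ := exists_between (lt_min hε hδ)
  have hsub : ∀ t ∈ Icc (-r) r, t ∈ Ioo (-ε) ε ∧ η t ∈ U := by
    intro t ht
    refine ⟨⟨by linarith [ht.1, hrm.trans_le (min_le_left _ _)],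
      by linarith [ht.2, hrm.trans_le (min_le_left _ _)]⟩, hδU t ?_⟩
    rw [Metric.mem_ball, Real.dist_eq, sub_zero]
    exact (abs_le.2 ht).trans_lt (hrm.trans_le (min_le_right _ _))
  refine ⟨η, h0, r, hr, ?_, fun t ht => ?_⟩
  · refine (ODE.contDiffOn_enat_Icc_of_hasDerivWithinAt (f := fun _ => f) (n := ⊤) (u := U) ?_ ?_
      ?_).mono Ioo_subset_Icc_self
    · exact hf.comp contDiffOn_snd (fun z hz => hz.2)
    · exact fun t ht => (hη t (hsub t ht).1).hasDerivWithinAt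
    · exact fun t ht => (hsub t ht).2
  · have := hsub t (Ioo_subset_Icc_self ht)
    exact ⟨this.2, hη t this.1⟩

/-- A function with vanishing first derivative and nonvanishing second derivative at `0` is not
`o(t²)`. -/
theorem not_isLittleO_sq_of_hasDerivAt {β β' : ℝ → ℝ} {b : ℝ} (h0 : β 0 = 0)
    (h1 : ∀ᶠ t in 𝓝 0, HasDerivAt β (β' t) t) (h1' : β' 0 = 0) (h2 : HasDerivAt β' b 0)
    (hb : b ≠ 0) : ¬ β =o[𝓝 0] fun t => t ^ 2 := by
  intro ho
  -- L'Hôpital is applied once; the remaining limit is half the derivative of `β'` at `0`, so `β'`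
  -- need only be differentiable there.
  have hlim : Tendsto (fun t => β t / t ^ 2) (𝓝[≠] 0) (𝓝 (b / 2)) := by
    refine HasDerivAt.lhopital_zero_nhdsNE (f' := β') (g' := fun t => 2 * t)
      (h1.filter_mono nhdsWithin_le_nhds) ?_ ?_ ?_ ?_ ?_
    · exact Eventually.of_forall fun t => by simpa using hasDerivAt_pow 2 t
    · filter_upwards [self_mem_nhdsWithin] with t ht
      simpa using ht
    · have := h1.self_of_nhds.continuousAt.tendsto
      rw [h0] at this
      exact this.mono_left nhdsWithin_le_nhds
    · have : ContinuousAt (fun t : ℝ => t ^ 2) 0 := by fun_prop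
      have := this.tendsto
      simp only [ne_eq, OfNat.ofNat_ne_zero, not_false_eq_true, zero_pow] at this
      exact this.mono_left nhdsWithin_le_nhds
    · have := h2.tendsto_slope
      have h3 := this.div_const 2
      refine h3.congr' ?_
      filter_upwards [self_mem_nhdsWithin] with t ht
      simp only [slope_def_field, h1', sub_zero]
      have : t ≠ 0 := ht
      field_simp
  have hz : Tendsto (fun t => β t / t ^ 2) (𝓝[≠] 0) (𝓝 0) :=
    ho.tendsto_div_nhds_zero.mono_left nhdsWithin_le_nhds
  have := tendsto_nhds_unique hlim hz
  exact hb (by linarith)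

end UmbilicCurve

/-! ### Orthonormal frames, the shape operator and the structure equations. -/

namespace UmbilicCurve

theorem inner_wedge_left (x y : E3) : inner ℝ x (wedge x y) = 0 := by
  rw [real_inner_comm, EuclideanSpace.inner_eq_star_dotProduct]
  simp [wedge, dot_self_cross]

theorem inner_wedge_right (x y : E3) : inner ℝ y (wedge x y) = 0 := by
  rw [real_inner_comm, EuclideanSpace.inner_eq_star_dotProduct]
  simp [wedge, dot_cross_self]

theorem inner_wedge_wedge (x y z w : E3) : inner ℝ (wedge x y) (wedge z w) =
    inner ℝ x z * inner ℝ y w - inner ℝ x w * inner ℝ y z := by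
  simp only [EuclideanSpace.inner_eq_star_dotProduct]
  simp [wedge, cross_dot_cross, dotProduct_comm]

theorem contDiff_wedge : ContDiff ℝ ∞ fun z : E3 × E3 => wedge z.1 z.2 := by
  rw [contDiff_euclidean]
  intro i
  fin_cases i <;> simp [wedge, cross_apply] <;> fun_prop

theorem _root_.ContDiffOn.wedge {E : Type*} [NormedAddCommGroup E] [NormedSpace ℝ E] {f g : E → E3}
    {s : Set E} (hf : ContDiffOn ℝ ∞ f s) (hg : ContDiffOn ℝ ∞ g s) :
    ContDiffOn ℝ ∞ (fun x => wedge (f x) (g x)) s :=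
  contDiff_wedge.comp_contDiffOn (hf.prodMk hg)

theorem orthonormal_vec3_iff {a b n : E3} : Orthonormal ℝ ![a, b, n] ↔
    ‖a‖ = 1 ∧ ‖b‖ = 1 ∧ ‖n‖ = 1 ∧ inner ℝ a b = 0 ∧ inner ℝ a n = 0 ∧ inner ℝ b n = 0 := by
  constructor
  · rintro ⟨h1, h2⟩
    exact ⟨h1 0, h1 1, h1 2, h2 (i := 0) (j := 1) (by decide), h2 (i := 0) (j := 2) (by decide),
      h2 (i := 1) (j := 2) (by decide)⟩
  · rintro ⟨ha, hb, hn, hab, han, hbn⟩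
    refine ⟨fun i => by fin_cases i <;> assumption, fun i j hij => ?_⟩
    fin_cases i <;> fin_cases j <;>
      first
      | exact absurd rfl hij
      | assumption
      | (rw [real_inner_comm]; assumption)

theorem orthonormal_wedge {e n : E3} (he : ‖e‖ = 1) (hn : ‖n‖ = 1) (hne : inner ℝ n e = 0) :
    Orthonormal ℝ ![e, wedge n e, n] := by
  refine orthonormal_vec3_iff.2 ⟨he, ?_, hn, inner_wedge_right _ _, by rwa [real_inner_comm],
    by rw [real_inner_comm]; exact inner_wedge_left _ _⟩
  have h := inner_wedge_wedge n e n e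
  rw [real_inner_self_eq_norm_sq, real_inner_self_eq_norm_sq, real_inner_self_eq_norm_sq, hne, he,
    hn] at h
  have h2 : ‖wedge n e‖ ^ 2 = 1 := by linarith
  exact (pow_eq_one_iff_of_nonneg (norm_nonneg _) two_ne_zero).1 h2

/-- The orthonormal basis with prescribed members. -/
noncomputable def frameBasis {a b n : E3} (h : Orthonormal ℝ ![a, b, n]) :
    OrthonormalBasis (Fin 3) ℝ E3 :=
  OrthonormalBasis.mk h (by
    have hc : Fintype.card (Fin 3) = Module.finrank ℝ E3 := by simp
    rw [h.linearIndependent.span_eq_top_of_card_eq_finrank hc])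

theorem frameBasis_apply {a b n : E3} (h : Orthonormal ℝ ![a, b, n]) (i : Fin 3) :
    frameBasis h i = ![a, b, n] i := by
  simp [frameBasis]

theorem eq_sum_of_orthonormal {a b n : E3} (h : Orthonormal ℝ ![a, b, n]) (w : E3) :
    w = inner ℝ a w • a + inner ℝ b w • b + inner ℝ n w • n := by
  have := (frameBasis h).sum_repr' w
  simp only [Fin.sum_univ_three, frameBasis_apply] at this
  exact this.symm

theorem trace_eq_of_orthonormal {a b n : E3} (h : Orthonormal ℝ ![a, b, n]) (L : E3 →ₗ[ℝ] E3) :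
    LinearMap.trace ℝ E3 L = inner ℝ a (L a) + inner ℝ b (L b) + inner ℝ n (L n) := by
  rw [L.trace_eq_sum_inner (frameBasis h)]
  simp [Fin.sum_univ_three, frameBasis_apply]

theorem shapeOperator_apply (N : E3 → E3) (p w : E3) :
    shapeOperator N p w = -fderiv ℝ N p (w - inner ℝ (N p) w • N p) := by
  simp [shapeOperator]

theorem shapeOperator_apply_tangent {N : E3 → E3} {p w : E3} (h : inner ℝ (N p) w = 0) :
    shapeOperator N p w = -fderiv ℝ N p w := by
  simp [shapeOperator_apply, h]

theorem shapeOperator_normal {N : E3 → E3} {p : E3} (h : ‖N p‖ = 1) :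
    shapeOperator N p (N p) = 0 := by
  simp [shapeOperator_apply, h]

theorem contDiffOn_shapeOperator {N : E3 → E3} {W : Set E3} (hW : IsOpen W)
    (hN : ContDiffOn ℝ ∞ N W) : ContDiffOn ℝ ∞ (shapeOperator N) W := by
  refine ContDiffOn.neg (ContDiffOn.clm_comp (hN.fderiv_of_isOpen hW (by simp)) ?_)
  exact contDiffOn_const.sub (((innerSL ℝ).contDiff.comp_contDiffOn hN).smulRight hN)

variable {M : Set E3} {N : E3 → E3}

/-- The defining function vanishes along `f`, so its differential, a nonzero multiple of `⟨N, ·⟩`,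
kills the image of `f'`. The domain is arbitrary so that curves and charts are both covered. -/
theorem IsOrientedSurface.inner_normal_fderiv (hM : IsOrientedSurface M N) {E : Type*}
    [NormedAddCommGroup E] [NormedSpace ℝ E] {f : E → E3} {f' : E →L[ℝ] E3} {x : E}
    (hf : HasFDerivAt f f' x) (hmem : ∀ᶠ y in 𝓝 x, f y ∈ M) (w : E) :
    inner ℝ (N (f x)) (f' w) = 0 := by
  have hx : f x ∈ M := hmem.self_of_nhds
  obtain ⟨V, F, hV, hxV, hF, hFM, hgrad⟩ := hM.regular (f x) hx
  obtain ⟨μ, hμ, hμF⟩ := hgrad (f x) ⟨hx, hxV⟩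
  have hd := (((hF.contDiffAt (hV.mem_nhds hxV)).differentiableAt (by simp)).hasFDerivAt).comp x hf
  have h0 : F ∘ f =ᶠ[𝓝 x] fun _ => 0 := by
    filter_upwards [hmem, hf.continuousAt (hV.mem_nhds hxV)] with y hy hyV
    exact (hFM _ hyV).1 hy
  have h1 := (hd.congr_of_eventuallyEq h0.symm).unique (hasFDerivAt_const (0 : ℝ) x)
  have h2 := congrArg (fun L : E →L[ℝ] ℝ => L w) h1
  simp only [ContinuousLinearMap.comp_apply, hμF, zero_apply] at h2
  exact (mul_eq_zero.1 h2).resolve_left hμ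

/-- The image of `f'` is tangent, and on tangent vectors the projection inside `shapeOperator` is
the identity; the rest is the chain rule. -/
theorem IsOrientedSurface.hasFDerivAt_normal (hM : IsOrientedSurface M N) {E : Type*}
    [NormedAddCommGroup E] [NormedSpace ℝ E] {f : E → E3} {f' : E →L[ℝ] E3} {x : E}
    (hf : HasFDerivAt f f' x) (hmem : ∀ᶠ y in 𝓝 x, f y ∈ M) :
    HasFDerivAt (fun y => N (f y)) (-(shapeOperator N (f x) ∘L f')) x := by
  obtain ⟨W, hW, hMW, hN⟩ := hM.smooth_normal
  have hd := (((hN.contDiffAt (hW.mem_nhds (hMW hmem.self_of_nhds))).differentiableAt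
    (by simp)).hasFDerivAt).comp x hf
  refine hd.congr_fderiv ?_
  ext1 w
  simp [shapeOperator_apply_tangent (hM.inner_normal_fderiv hf hmem w)]

/-- A smooth map `α` from the open plane set `U`, with values in a surface with unit normal
field `N`, together with the structure equations it satisfies. -/
structure IsPatch (N : E3 → E3) (α : ℝ × ℝ → E3) (U : Set (ℝ × ℝ)) : Prop where
  isOpen : IsOpen U
  smooth : ContDiffOn ℝ ∞ α U
  smooth_normal : ContDiffOn ℝ ∞ (fun q => N (α q)) U
  smooth_shape : ContDiffOn ℝ ∞ (fun q => shapeOperator N (α q)) U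
  unit_normal : ∀ q ∈ U, ‖N (α q)‖ = 1
  tangent : ∀ q ∈ U, ∀ w, inner ℝ (N (α q)) (fderiv ℝ α q w) = 0
  hasFDerivAt_normal : ∀ q ∈ U,
    HasFDerivAt (fun q => N (α q)) (-(shapeOperator N (α q) ∘L fderiv ℝ α q)) q

theorem IsOrientedSurface.isPatch (hM : IsOrientedSurface M N) {α : ℝ × ℝ → E3}
    {U : Set (ℝ × ℝ)} (hU : IsOpen U) (hα : ContDiffOn ℝ ∞ α U) (hmem : MapsTo α U M) :
    IsPatch N α U := by
  obtain ⟨W, hW, hMW, hN⟩ := hM.smooth_normal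
  have hev : ∀ q ∈ U, ∀ᶠ y in 𝓝 q, α y ∈ M := fun q hq =>
    (hU.eventually_mem hq).mono fun y hy => hmem hy
  have hd : ∀ q ∈ U, HasFDerivAt α (fderiv ℝ α q) q := fun q hq =>
    ((hα.contDiffAt (hU.mem_nhds hq)).differentiableAt (by simp)).hasFDerivAt
  exact ⟨hU, hα, hN.comp hα (hmem.mono_right hMW),
    (contDiffOn_shapeOperator hW hN).comp hα (hmem.mono_right hMW),
    fun q hq => hM.unit_normal _ (hmem hq),
    fun q hq => hM.inner_normal_fderiv (hd q hq) (hev q hq),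
    fun q hq => hM.hasFDerivAt_normal (hd q hq) (hev q hq)⟩

theorem _root_.ContDiffOn.fderiv_const_apply {E F : Type*} [NormedAddCommGroup E] [NormedSpace ℝ E]
    [NormedAddCommGroup F] [NormedSpace ℝ F] {f : E → F} {U : Set E} (hU : IsOpen U)
    (hf : ContDiffOn ℝ ∞ f U) (w : E) : ContDiffOn ℝ ∞ (fun x => fderiv ℝ f x w) U :=
  (hf.fderiv_of_isOpen hU (by simp)).clm_apply contDiffOn_const

theorem _root_.ContDiffOn.differentiableAt_of_isOpen {E F : Type*} [NormedAddCommGroup E]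
    [NormedSpace ℝ E] [NormedAddCommGroup F] [NormedSpace ℝ F] {f : E → F} {U : Set E}
    (hf : ContDiffOn ℝ ∞ f U) (hU : IsOpen U) {x : E} (hx : x ∈ U) : DifferentiableAt ℝ f x :=
  (hf.contDiffAt (hU.mem_nhds hx)).differentiableAt (by simp)

theorem fderiv_fderiv_comm {E F : Type*} [NormedAddCommGroup E]
    [NormedSpace ℝ E] [NormedAddCommGroup F] [NormedSpace ℝ F] {f : E → F} {U : Set E}
    (hf : ContDiffOn ℝ ∞ f U) (hU : IsOpen U) {x : E} (hx : x ∈ U) (v w : E) :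
    fderiv ℝ (fun y => fderiv ℝ f y w) x v = fderiv ℝ (fun y => fderiv ℝ f y v) x w := by
  have hd : DifferentiableAt ℝ (fderiv ℝ f) x :=
    ((hf.fderiv_of_isOpen (m := ∞) hU (by simp)).contDiffAt (hU.mem_nhds hx)).differentiableAt
      (by simp)
  have hs := (hf.contDiffAt (hU.mem_nhds hx)).isSymmSndFDerivAt
    (by simpa using WithTop.coe_le_coe.2 (le_top (a := (2 : ℕ∞))))
  rw [fderiv_clm_apply hd (differentiableAt_const _), fderiv_clm_apply hd (differentiableAt_const _)]
  simpa using hs v w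

namespace IsPatch

variable {α : ℝ × ℝ → E3} {U : Set (ℝ × ℝ)}

/-- The second fundamental form. -/
theorem inner_shapeOperator (h : IsPatch N α U) {q : ℝ × ℝ} (hq : q ∈ U) (v w : ℝ × ℝ) :
    inner ℝ (shapeOperator N (α q) (fderiv ℝ α q v)) (fderiv ℝ α q w) =
      inner ℝ (N (α q)) (fderiv ℝ (fun y => fderiv ℝ α y w) q v) := by
  have h1 := (h.hasFDerivAt_normal q hq).inner ℝ (((h.smooth.fderiv_const_apply h.isOpen
    w).differentiableAt_of_isOpen h.isOpen hq).hasFDerivAt)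
  have h0 : (fun y => inner ℝ (N (α y)) (fderiv ℝ α y w)) =ᶠ[𝓝 q] fun _ => (0 : ℝ) := by
    filter_upwards [h.isOpen.mem_nhds hq] with y hy using h.tangent y hy w
  have h2 := (h1.congr_of_eventuallyEq h0.symm).unique (hasFDerivAt_const (0 : ℝ) q)
  have h3 := congrArg (fun L : ℝ × ℝ →L[ℝ] ℝ => L v) h2
  simp [fderivInnerCLM_apply] at h3
  linarith

/-- The Codazzi equation. -/
theorem codazzi (h : IsPatch N α U) {q : ℝ × ℝ} (hq : q ∈ U) (v w : ℝ × ℝ) :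
    fderiv ℝ (fun y => shapeOperator N (α y)) q v (fderiv ℝ α q w) =
      fderiv ℝ (fun y => shapeOperator N (α y)) q w (fderiv ℝ α q v) := by
  have hA := h.smooth_shape.differentiableAt_of_isOpen h.isOpen hq
  -- Differentiate `∂_w (N ∘ α) = -S (∂_w α)`; the symmetry of the second derivatives of `N ∘ α` and
  -- of `α` leaves only the Codazzi terms.
  have key : ∀ v w, fderiv ℝ (fun y => fderiv ℝ (fun y => N (α y)) y w) q v =
      -(fderiv ℝ (fun y => shapeOperator N (α y)) q v (fderiv ℝ α q w) +
        shapeOperator N (α q) (fderiv ℝ (fun y => fderiv ℝ α y w) q v)) := by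
    intro v w
    have h0 : (fun y => fderiv ℝ (fun y => N (α y)) y w) =ᶠ[𝓝 q]
        fun y => -(shapeOperator N (α y) (fderiv ℝ α y w)) := by
      filter_upwards [h.isOpen.mem_nhds hq] with y hy
      rw [(h.hasFDerivAt_normal y hy).fderiv]
      simp
    rw [h0.fderiv_eq, fderiv_fun_neg, fderiv_clm_apply hA ((h.smooth.fderiv_const_apply h.isOpen
      w).differentiableAt_of_isOpen h.isOpen hq)]
    simp [add_comm]
  have h1 := key v w
  rw [fderiv_fderiv_comm h.smooth_normal h.isOpen hq, key w v,
    fderiv_fderiv_comm h.smooth h.isOpen hq w v] at h1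
  exact (add_right_cancel (neg_injective h1)).symm

/-- The image of the injective differential and the tangent plane both have dimension two, and the
first lies in the second. -/
theorem exists_fderiv_eq (h : IsPatch N α U) {q : ℝ × ℝ} (hq : q ∈ U)
    (hinj : Function.Injective (fderiv ℝ α q)) {x : E3} (hx : inner ℝ (N (α q)) x = 0) :
    ∃ w, fderiv ℝ α q w = x := by
  let R := LinearMap.range (fderiv ℝ α q : ℝ × ℝ →ₗ[ℝ] E3)
  have hle : R ≤ (ℝ ∙ N (α q))ᗮ := by
    rintro _ ⟨w, rfl⟩
    exact Submodule.mem_orthogonal_singleton_iff_inner_right.2 (h.tangent q hq w)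
  have hN : N (α q) ≠ 0 := by
    intro h0
    have := h.unit_normal q hq
    simp [h0] at this
  have h1 : Module.finrank ℝ R = 2 := by
    rw [LinearMap.finrank_range_of_inj hinj]
    simp
  have h2 : Module.finrank ℝ (ℝ ∙ N (α q))ᗮ = 2 := by
    have : Fact (Module.finrank ℝ E3 = 2 + 1) := ⟨by simp⟩
    exact Submodule.finrank_orthogonal_span_singleton hN
  have heq := Submodule.eq_of_le_of_finrank_eq hle (h1.trans h2.symm)
  have : x ∈ R := heq ▸ Submodule.mem_orthogonal_singleton_iff_inner_right.2 hx
  exact this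

/-- Both sides are the normal component of a mixed second derivative of `α`, and these commute. -/
theorem inner_shapeOperator_comm (h : IsPatch N α U) {q : ℝ × ℝ} (hq : q ∈ U)
    (hinj : Function.Injective (fderiv ℝ α q)) {x y : E3} (hx : inner ℝ (N (α q)) x = 0)
    (hy : inner ℝ (N (α q)) y = 0) :
    inner ℝ (shapeOperator N (α q) x) y = inner ℝ (shapeOperator N (α q) y) x := by
  obtain ⟨v, rfl⟩ := h.exists_fderiv_eq hq hinj hx
  obtain ⟨w, rfl⟩ := h.exists_fderiv_eq hq hinj hy
  rw [h.inner_shapeOperator hq, h.inner_shapeOperator hq,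
    fderiv_fderiv_comm h.smooth h.isOpen hq]

/-- Differentiate `⟨N, N⟩ = 1`. -/
theorem inner_normal_shapeOperator (h : IsPatch N α U) {q : ℝ × ℝ} (hq : q ∈ U)
    (hinj : Function.Injective (fderiv ℝ α q)) {x : E3} (hx : inner ℝ (N (α q)) x = 0) :
    inner ℝ (N (α q)) (shapeOperator N (α q) x) = 0 := by
  obtain ⟨v, rfl⟩ := h.exists_fderiv_eq hq hinj hx
  have h1 := (h.hasFDerivAt_normal q hq).inner ℝ (h.hasFDerivAt_normal q hq)
  have h0 : (fun y => inner ℝ (N (α y)) (N (α y))) =ᶠ[𝓝 q] fun _ => (1 : ℝ) := by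
    filter_upwards [h.isOpen.mem_nhds hq] with y hy
    rw [real_inner_self_eq_norm_sq, h.unit_normal y hy, one_pow]
  have h2 := (h1.congr_of_eventuallyEq h0.symm).unique (hasFDerivAt_const (1 : ℝ) q)
  have h3 := congrArg (fun L : ℝ × ℝ →L[ℝ] ℝ => L v) h2
  simp [fderivInnerCLM_apply] at h3
  rw [real_inner_comm (N (α q))] at h3
  linarith

/-- At an umbilic point the coefficients of the shape operator in an orthonormal frame are
differentiated as if the frame were constant. -/
theorem fderiv_inner_shapeOperator (h : IsPatch N α U) {q : ℝ × ℝ} (hq : q ∈ U) {κ : ℝ}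
    (hκ : ∀ w, inner ℝ (N (α q)) w = 0 → shapeOperator N (α q) w = κ • w)
    {e f : ℝ × ℝ → E3} (he : DifferentiableAt ℝ e q) (hf : DifferentiableAt ℝ f q)
    (hne : inner ℝ (N (α q)) (e q) = 0) (hnf : inner ℝ (N (α q)) (f q) = 0) {r : ℝ}
    (hef : ∀ᶠ y in 𝓝 q, inner ℝ (e y) (f y) = r) (v : ℝ × ℝ) :
    fderiv ℝ (fun y => inner ℝ (shapeOperator N (α y) (e y)) (f y)) q v =
      inner ℝ (fderiv ℝ (fun y => shapeOperator N (α y)) q v (e q)) (f q) := by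
  have hA := h.smooth_shape.differentiableAt_of_isOpen h.isOpen hq
  rw [fderiv_inner_apply ℝ (hA.clm_apply he) hf, fderiv_clm_apply hA he, hκ _ hne]
  -- This holds for non-tangent `w` too, as is needed for derivatives of the frame: the operator
  -- kills the normal and `f q` is orthogonal to it. The frame terms then add up to `κ` times the
  -- derivative of the constant `⟨e, f⟩`.
  have h1 : ∀ w, inner ℝ (shapeOperator N (α q) w) (f q) = κ * inner ℝ w (f q) := by
    intro w
    have hw : inner ℝ (N (α q)) (w - inner ℝ (N (α q)) w • N (α q)) = 0 := by
      simp [inner_sub_right, inner_smul_right, h.unit_normal q hq]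
    have h2 := hκ _ hw
    rw [map_sub, map_smul, shapeOperator_normal (h.unit_normal q hq), smul_zero, sub_zero] at h2
    rw [h2, inner_smul_left, inner_sub_left, inner_smul_left, hnf]
    simp
  have h2 : inner ℝ (e q) (fderiv ℝ f q v) + inner ℝ (fderiv ℝ e q v) (f q) = 0 := by
    rw [← fderiv_inner_apply ℝ he hf]
    have : (fun y => inner ℝ (e y) (f y)) =ᶠ[𝓝 q] fun _ => r := hef
    rw [this.fderiv_eq]
    simp
  simp only [add_apply, ContinuousLinearMap.comp_apply,
    ContinuousLinearMap.flip_apply, inner_add_left, h1, inner_smul_left]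
  simp only [conj_trivial]
  linear_combination κ * h2

end IsPatch

end UmbilicCurve

/-! ### The umbilic curve and the derivatives of the strip chart along it. -/

namespace UmbilicCurve

variable {M : Set E3} {N : E3 → E3} {l : ℝ} {c : ℝ → E3}

/-- The vector `(N ∧ T)(u)`. -/
noncomputable def conormal (N : E3 → E3) (c : ℝ → E3) (u : ℝ) : E3 :=
  wedge (N (c u)) (deriv c u)

namespace IsUmbilicCurve

theorem contDiffOn_Ioo (hc : IsUmbilicCurve M N l c) : ContDiffOn ℝ ∞ c (Ioo 0 l) :=
  hc.smooth.mono Ioo_subset_Icc_self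

theorem contDiffOn_deriv (hc : IsUmbilicCurve M N l c) : ContDiffOn ℝ ∞ (deriv c) (Ioo 0 l) :=
  hc.contDiffOn_Ioo.deriv_of_isOpen isOpen_Ioo (by simp)

theorem contDiffOn_normal (hM : IsOrientedSurface M N) (hc : IsUmbilicCurve M N l c) :
    ContDiffOn ℝ ∞ (fun u => N (c u)) (Ioo 0 l) := by
  obtain ⟨W, -, hMW, hN⟩ := hM.smooth_normal
  exact hN.comp hc.contDiffOn_Ioo fun u hu => hMW (hc.mem u (Ioo_subset_Icc_self hu))

theorem contDiffOn_conormal (hM : IsOrientedSurface M N) (hc : IsUmbilicCurve M N l c) :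
    ContDiffOn ℝ ∞ (conormal N c) (Ioo 0 l) :=
  (hc.contDiffOn_normal hM).wedge hc.contDiffOn_deriv

theorem contDiffOn_curvatureAlong (hM : IsOrientedSurface M N) (hc : IsUmbilicCurve M N l c) :
    ContDiffOn ℝ ∞ (curvatureAlong N c) (Ioo 0 l) := by
  obtain ⟨W, hW, hMW, hN⟩ := hM.smooth_normal
  exact ((((contDiffOn_shapeOperator hW hN).comp hc.contDiffOn_Ioo fun u hu =>
    hMW (hc.mem u (Ioo_subset_Icc_self hu))).clm_apply hc.contDiffOn_deriv).inner ℝ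
    hc.contDiffOn_deriv)

theorem hasDerivAt (hc : IsUmbilicCurve M N l c) {u : ℝ} (hu : u ∈ Ioo 0 l) :
    HasDerivAt c (deriv c u) u :=
  (hc.contDiffOn_Ioo.differentiableAt_of_isOpen isOpen_Ioo hu).hasDerivAt

theorem eventually_mem (hc : IsUmbilicCurve M N l c) {u : ℝ} (hu : u ∈ Ioo 0 l) :
    ∀ᶠ s in 𝓝 u, c s ∈ M := by
  filter_upwards [isOpen_Ioo.mem_nhds hu] with s hs using hc.mem s (Ioo_subset_Icc_self hs)

theorem inner_normal_deriv (hM : IsOrientedSurface M N) (hc : IsUmbilicCurve M N l c) {u : ℝ}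
    (hu : u ∈ Ioo 0 l) : inner ℝ (N (c u)) (deriv c u) = 0 := by
  simpa using hM.inner_normal_fderiv (hc.hasDerivAt hu).hasFDerivAt (hc.eventually_mem hu) 1

theorem orthonormal (hM : IsOrientedSurface M N) (hc : IsUmbilicCurve M N l c) {u : ℝ}
    (hu : u ∈ Ioo 0 l) : Orthonormal ℝ ![deriv c u, conormal N c u, N (c u)] :=
  orthonormal_wedge (hc.unit_speed u hu) (hM.unit_normal _ (hc.mem u (Ioo_subset_Icc_self hu)))
    (hc.inner_normal_deriv hM hu)

theorem shapeOperator_eq (hM : IsOrientedSurface M N) (hc : IsUmbilicCurve M N l c) {u : ℝ}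
    (hu : u ∈ Ioo 0 l) (w : E3) (hw : inner ℝ (N (c u)) w = 0) :
    shapeOperator N (c u) w = curvatureAlong N c u • w := by
  obtain ⟨κ, hκ⟩ := hc.umbilic u (Ioo_subset_Icc_self hu)
  have : curvatureAlong N c u = κ := by
    rw [curvatureAlong, normalCurvature, hκ _ (hc.inner_normal_deriv hM hu), inner_smul_left,
      real_inner_self_eq_norm_sq, hc.unit_speed u hu]
    simp
  rw [this, hκ w hw]

theorem hasDerivAt_normal (hM : IsOrientedSurface M N) (hc : IsUmbilicCurve M N l c) {u : ℝ}
    (hu : u ∈ Ioo 0 l) :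
    HasDerivAt (fun s => N (c s)) (-(curvatureAlong N c u • deriv c u)) u := by
  have h := (hM.hasFDerivAt_normal (hc.hasDerivAt hu).hasFDerivAt (hc.eventually_mem hu)).hasDerivAt
  simpa [hc.shapeOperator_eq hM hu _ (hc.inner_normal_deriv hM hu)] using h

/-- Differentiate `⟨N, B⟩ = 0`: umbilicity gives `N' = -k T`, orthogonal to `B`. So `B'` is tangent
and the shape operator multiplies it by `k`. -/
theorem inner_normal_deriv_conormal (hM : IsOrientedSurface M N) (hc : IsUmbilicCurve M N l c)
    {u : ℝ} (hu : u ∈ Ioo 0 l) : inner ℝ (N (c u)) (deriv (conormal N c) u) = 0 := by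
  have h1 := (hc.hasDerivAt_normal hM hu).inner ℝ
    ((hc.contDiffOn_conormal hM).differentiableAt_of_isOpen isOpen_Ioo hu).hasDerivAt
  have h0 : (fun s => inner ℝ (N (c s)) (conormal N c s)) =ᶠ[𝓝 u] fun _ => (0 : ℝ) :=
    Eventually.of_forall fun s => inner_wedge_left _ _
  have h2 := (h1.congr_of_eventuallyEq h0.symm).unique (hasDerivAt_const u (0 : ℝ))
  have h3 : inner ℝ (deriv c u) (conormal N c u) = 0 := inner_wedge_right _ _
  rw [inner_neg_left, inner_smul_left, h3] at h2
  simpa using h2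

end IsUmbilicCurve

theorem hasDerivAt_slice_snd {F : Type*} [NormedAddCommGroup F] [NormedSpace ℝ F] {f : ℝ × ℝ → F}
    {q : ℝ × ℝ} (hf : DifferentiableAt ℝ f q) :
    HasDerivAt (fun s => f (q.1, s)) (fderiv ℝ f q (0, 1)) q.2 :=
  HasFDerivAt.comp_hasDerivAt q.2 (f := fun s : ℝ => (q.1, s)) (show HasFDerivAt f _ (q.1, q.2) from
    hf.hasFDerivAt) ((hasDerivAt_const _ _).prodMk (hasDerivAt_id _))

theorem hasDerivAt_slice_fst {F : Type*} [NormedAddCommGroup F] [NormedSpace ℝ F] {f : ℝ × ℝ → F}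
    {q : ℝ × ℝ} (hf : DifferentiableAt ℝ f q) :
    HasDerivAt (fun s => f (s, q.2)) (fderiv ℝ f q (1, 0)) q.1 :=
  HasFDerivAt.comp_hasDerivAt q.1 (f := fun s : ℝ => (s, q.2)) (show HasFDerivAt f _ (q.1, q.2) from
    hf.hasFDerivAt) ((hasDerivAt_id _).prodMk (hasDerivAt_const _ _))

theorem eventually_slice_snd {U : Set (ℝ × ℝ)} (hU : IsOpen U) {q : ℝ × ℝ} (hq : q ∈ U) :
    ∀ᶠ s in 𝓝 q.2, (q.1, s) ∈ U :=
  (Continuous.prodMk_right q.1).continuousAt (hU.mem_nhds hq)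

theorem eventually_slice_fst {U : Set (ℝ × ℝ)} (hU : IsOpen U) {q : ℝ × ℝ} (hq : q ∈ U) :
    ∀ᶠ s in 𝓝 q.1, (s, q.2) ∈ U :=
  (Continuous.prodMk_left q.2).continuousAt (hU.mem_nhds hq)

/-- The map `(u,v,w) ↦ c(u) + v (N ∧ T)(u) + w N(u)`. -/
noncomputable def tubeMap (N : E3 → E3) (c : ℝ → E3) (z : (ℝ × ℝ) × ℝ) : E3 :=
  c z.1.1 + z.1.2 • conormal N c z.1.1 + z.2 • N (c z.1.1)

theorem stripChart_eq_tubeMap (h : ℝ × ℝ → ℝ) (q : ℝ × ℝ) :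
    stripChart N c h q = tubeMap N c (q, h q) := rfl

theorem contDiffOn_tubeMap (hM : IsOrientedSurface M N) (hc : IsUmbilicCurve M N l c) :
    ContDiffOn ℝ ∞ (tubeMap N c) {z | z.1.1 ∈ Ioo 0 l} := by
  have hf : ContDiffOn ℝ ∞ (fun z : (ℝ × ℝ) × ℝ => z.1.1) {z | z.1.1 ∈ Ioo 0 l} := by fun_prop
  have h1 : ContDiffOn ℝ ∞ (fun z : (ℝ × ℝ) × ℝ => z.1.2) {z | z.1.1 ∈ Ioo 0 l} := by fun_prop
  exact ((hc.contDiffOn_Ioo.comp hf fun z hz => hz).add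
    (h1.smul ((hc.contDiffOn_conormal hM).comp hf fun z hz => hz))).add
    (contDiffOn_snd.smul ((hc.contDiffOn_normal hM).comp hf fun z hz => hz))

/-- A smooth function `h` on the open set `U`, vanishing for `v = 0`, whose strip chart takes values
in the surface. -/
structure IsStrip (M : Set E3) (N : E3 → E3) (l : ℝ) (c : ℝ → E3) (h : ℝ × ℝ → ℝ)
    (U : Set (ℝ × ℝ)) : Prop where
  isOpen : IsOpen U
  smooth : ContDiffOn ℝ ∞ h U
  mem_Ioo : ∀ q ∈ U, q.1 ∈ Ioo 0 l
  mapsTo : MapsTo (stripChart N c h) U M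
  zero : ∀ u, (u, 0) ∈ U → h (u, 0) = 0

namespace IsStrip

variable {h : ℝ × ℝ → ℝ} {U : Set (ℝ × ℝ)}

theorem mono (hs : IsStrip M N l c h U) {U' : Set (ℝ × ℝ)} (hU' : IsOpen U') (hsub : U' ⊆ U) :
    IsStrip M N l c h U' :=
  ⟨hU', hs.smooth.mono hsub, fun q hq => hs.mem_Ioo q (hsub hq), hs.mapsTo.mono_left hsub,
    fun u hu => hs.zero u (hsub hu)⟩

theorem contDiffOn_stripChart (hs : IsStrip M N l c h U) (hM : IsOrientedSurface M N)
    (hc : IsUmbilicCurve M N l c) : ContDiffOn ℝ ∞ (stripChart N c h) U :=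
  (contDiffOn_tubeMap hM hc).comp (contDiffOn_id.prodMk hs.smooth) hs.mem_Ioo

theorem isPatch (hs : IsStrip M N l c h U) (hM : IsOrientedSurface M N)
    (hc : IsUmbilicCurve M N l c) : IsPatch N (stripChart N c h) U :=
  hM.isPatch hs.isOpen (hs.contDiffOn_stripChart hM hc) hs.mapsTo

theorem differentiableAt (hs : IsStrip M N l c h U) {q : ℝ × ℝ} (hq : q ∈ U) :
    DifferentiableAt ℝ h q := hs.smooth.differentiableAt_of_isOpen hs.isOpen hq

theorem differentiableAt_snd (hs : IsStrip M N l c h U) {q : ℝ × ℝ} (hq : q ∈ U) :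
    DifferentiableAt ℝ (fun y => fderiv ℝ h y (0, 1)) q :=
  (hs.smooth.fderiv_const_apply hs.isOpen (0, 1)).differentiableAt_of_isOpen hs.isOpen hq

theorem differentiableAt_snd_snd (hs : IsStrip M N l c h U) {q : ℝ × ℝ} (hq : q ∈ U) :
    DifferentiableAt ℝ (fun y => fderiv ℝ (fun y => fderiv ℝ h y (0, 1)) y (0, 1)) q :=
  ((hs.smooth.fderiv_const_apply hs.isOpen (0, 1)).fderiv_const_apply hs.isOpen
    (0, 1)).differentiableAt_of_isOpen hs.isOpen hq

theorem fderiv_stripChart_snd (hs : IsStrip M N l c h U) (hM : IsOrientedSurface M N)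
    (hc : IsUmbilicCurve M N l c) {q : ℝ × ℝ} (hq : q ∈ U) :
    fderiv ℝ (stripChart N c h) q (0, 1) =
      conormal N c q.1 + fderiv ℝ h q (0, 1) • N (c q.1) := by
  refine (hasDerivAt_slice_snd ((hs.contDiffOn_stripChart hM hc).differentiableAt_of_isOpen
    hs.isOpen hq)).unique ?_
  have h1 := ((hasDerivAt_id q.2).smul_const (conormal N c q.1)).const_add (c q.1)
  have h2 := h1.add ((hasDerivAt_slice_snd (hs.differentiableAt hq)).smul_const (N (c q.1)))
  rw [one_smul] at h2
  exact h2

theorem fderiv_stripChart_snd_snd (hs : IsStrip M N l c h U) (hM : IsOrientedSurface M N)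
    (hc : IsUmbilicCurve M N l c) {q : ℝ × ℝ} (hq : q ∈ U) :
    fderiv ℝ (fun y => fderiv ℝ (stripChart N c h) y (0, 1)) q (0, 1) =
      fderiv ℝ (fun y => fderiv ℝ h y (0, 1)) q (0, 1) • N (c q.1) := by
  refine (hasDerivAt_slice_snd (((hs.contDiffOn_stripChart hM hc).fderiv_const_apply hs.isOpen
    (0, 1)).differentiableAt_of_isOpen hs.isOpen hq)).unique ?_
  have h2 := ((hasDerivAt_slice_snd (hs.differentiableAt_snd hq)).smul_const (N (c q.1))).const_add
    (conormal N c q.1)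
  refine h2.congr_of_eventuallyEq ?_
  filter_upwards [eventually_slice_snd hs.isOpen hq] with s hs'
  exact hs.fderiv_stripChart_snd hM hc hs'

theorem stripChart_axis (hs : IsStrip M N l c h U) {u : ℝ} (hu : (u, 0) ∈ U) :
    stripChart N c h (u, 0) = c u := by
  simp [stripChart, hs.zero u hu]

theorem fderiv_fst_axis (hs : IsStrip M N l c h U) (hM : IsOrientedSurface M N)
    (hc : IsUmbilicCurve M N l c) {u : ℝ} (hu : (u, 0) ∈ U) :
    fderiv ℝ (stripChart N c h) (u, 0) (1, 0) = deriv c u := by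
  refine (hasDerivAt_slice_fst ((hs.contDiffOn_stripChart hM hc).differentiableAt_of_isOpen
    hs.isOpen hu)).unique ((hc.hasDerivAt (hs.mem_Ioo _ hu)).congr_of_eventuallyEq ?_)
  filter_upwards [eventually_slice_fst hs.isOpen hu] with s hs'
  exact hs.stripChart_axis hs'

/-- The vector `α_v = B + h_v N(c)` must be tangent at `c u`. Thus the vanishing of the linear term
is forced by the chart taking values in `M`. -/
theorem fderiv_height_axis (hs : IsStrip M N l c h U) (hM : IsOrientedSurface M N)
    (hc : IsUmbilicCurve M N l c) {u : ℝ} (hu : (u, 0) ∈ U) : fderiv ℝ h (u, 0) (0, 1) = 0 := by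
  have h1 := (hs.isPatch hM hc).tangent _ hu (0, 1)
  obtain ⟨-, -, hn, -, -, hbn⟩ := orthonormal_vec3_iff.1 (hc.orthonormal hM (hs.mem_Ioo _ hu))
  rw [hs.fderiv_stripChart_snd hM hc hu, hs.stripChart_axis hu, inner_add_right, inner_smul_right,
    real_inner_self_eq_norm_sq, real_inner_comm] at h1
  dsimp only at h1 hn hbn
  rw [hn, hbn] at h1
  linarith

theorem fderiv_snd_axis (hs : IsStrip M N l c h U) (hM : IsOrientedSurface M N)
    (hc : IsUmbilicCurve M N l c) {u : ℝ} (hu : (u, 0) ∈ U) :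
    fderiv ℝ (stripChart N c h) (u, 0) (0, 1) = conormal N c u := by
  simp [hs.fderiv_stripChart_snd hM hc hu, hs.fderiv_height_axis hM hc hu]

/-- The strip chart moves in the fixed plane of `B` and `N(c)` as `v` varies, so `α_vv = h_vv N(c)`;
this is the second fundamental form on `α_v`. -/
theorem inner_shapeOperator_snd (hs : IsStrip M N l c h U) (hM : IsOrientedSurface M N)
    (hc : IsUmbilicCurve M N l c) {q : ℝ × ℝ} (hq : q ∈ U) :
    inner ℝ (shapeOperator N (stripChart N c h q) (fderiv ℝ (stripChart N c h) q (0, 1)))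
      (fderiv ℝ (stripChart N c h) q (0, 1)) =
    fderiv ℝ (fun y => fderiv ℝ h y (0, 1)) q (0, 1) *
      inner ℝ (N (stripChart N c h q)) (N (c q.1)) := by
  rw [(hs.isPatch hM hc).inner_shapeOperator hq, hs.fderiv_stripChart_snd_snd hM hc hq,
    inner_smul_right]

theorem shapeOperator_axis (hs : IsStrip M N l c h U) (hM : IsOrientedSurface M N)
    (hc : IsUmbilicCurve M N l c) {u : ℝ} (hu : (u, 0) ∈ U) (w : E3)
    (hw : inner ℝ (N (stripChart N c h (u, 0))) w = 0) :
    shapeOperator N (stripChart N c h (u, 0)) w = curvatureAlong N c u • w := by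
  rw [hs.stripChart_axis hu] at hw ⊢
  exact hc.shapeOperator_eq hM (hs.mem_Ioo _ hu) w hw

/-- At an umbilic the normal curvature in direction `B` equals the one in direction `T`. -/
theorem fderiv_fderiv_height_axis (hs : IsStrip M N l c h U) (hM : IsOrientedSurface M N)
    (hc : IsUmbilicCurve M N l c) {u : ℝ} (hu : (u, 0) ∈ U) :
    fderiv ℝ (fun y => fderiv ℝ h y (0, 1)) (u, 0) (0, 1) = curvatureAlong N c u := by
  have h1 := hs.inner_shapeOperator_snd hM hc hu
  obtain ⟨-, hb, hn, -, -, hbn⟩ := orthonormal_vec3_iff.1 (hc.orthonormal hM (hs.mem_Ioo _ hu))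
  dsimp only at hb hn hbn
  rw [hs.fderiv_snd_axis hM hc hu, hs.shapeOperator_axis hM hc hu _ (by
    rw [hs.stripChart_axis hu, real_inner_comm, hbn]), hs.stripChart_axis hu, inner_smul_left,
    real_inner_self_eq_norm_sq, real_inner_self_eq_norm_sq, hb, hn] at h1
  simpa using h1.symm

theorem deriv_height_slice (hs : IsStrip M N l c h U) {q : ℝ × ℝ} (hq : q ∈ U) :
    deriv (fun v => h (q.1, v)) q.2 = fderiv ℝ h q (0, 1) :=
  (hasDerivAt_slice_snd (hs.differentiableAt hq)).deriv

theorem iteratedDeriv_two_height (hs : IsStrip M N l c h U) {q : ℝ × ℝ} (hq : q ∈ U) :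
    iteratedDeriv 2 (fun v => h (q.1, v)) q.2 =
      fderiv ℝ (fun y => fderiv ℝ h y (0, 1)) q (0, 1) := by
  rw [iteratedDeriv_succ, iteratedDeriv_one]
  refine ((hasDerivAt_slice_snd (hs.differentiableAt_snd hq)).congr_of_eventuallyEq ?_).deriv
  filter_upwards [eventually_slice_snd hs.isOpen hq] with s hs'
  exact hs.deriv_height_slice hs'

theorem cubicCoeff_eq (hs : IsStrip M N l c h U) {u : ℝ} (hu : (u, 0) ∈ U) :
    fderiv ℝ (fun y => fderiv ℝ (fun y => fderiv ℝ h y (0, 1)) y (0, 1)) (u, 0) (0, 1) =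
      cubicCoeff h u := by
  have h1 := hasDerivAt_slice_snd (hs.differentiableAt_snd_snd hu)
  have h2 : iteratedDeriv 2 (fun v => h (u, v)) =ᶠ[𝓝 0]
      fun s => fderiv ℝ (fun y => fderiv ℝ h y (0, 1)) (u, s) (0, 1) := by
    filter_upwards [eventually_slice_snd hs.isOpen hu] with s hs'
    have h3 := hs.iteratedDeriv_two_height hs'
    dsimp only at h3
    exact h3
  rw [cubicCoeff, iteratedDeriv_succ, h2.deriv_eq]
  exact h1.deriv.symm

theorem differentiableAt_curvatureAlong (hs : IsStrip M N l c h U) (hM : IsOrientedSurface M N)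
    (hc : IsUmbilicCurve M N l c) {u : ℝ} (hu : (u, 0) ∈ U) :
    DifferentiableAt ℝ (curvatureAlong N c) u :=
  (hc.contDiffOn_curvatureAlong hM).differentiableAt_of_isOpen isOpen_Ioo (hs.mem_Ioo _ hu)

/-- Differentiate `S B = k B` along the axis. Since `B'` is tangent, `S B' = k B'` cancels on both
sides. -/
theorem fderiv_shape_fst_conormal (hs : IsStrip M N l c h U) (hM : IsOrientedSurface M N)
    (hc : IsUmbilicCurve M N l c) {u : ℝ} (hu : (u, 0) ∈ U) :
    fderiv ℝ (fun y => shapeOperator N (stripChart N c h y)) (u, 0) (1, 0) (conormal N c u) =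
      deriv (curvatureAlong N c) u • conormal N c u := by
  have hu' := hs.mem_Ioo _ hu
  have hA := hasDerivAt_slice_fst
    ((hs.isPatch hM hc).smooth_shape.differentiableAt_of_isOpen hs.isOpen hu)
  have hB := ((hc.contDiffOn_conormal hM).differentiableAt_of_isOpen isOpen_Ioo hu').hasDerivAt
  have h1 := hA.clm_apply hB
  have h2 := (hs.differentiableAt_curvatureAlong hM hc hu).hasDerivAt.smul hB
  have h3 := h1.unique (h2.congr_of_eventuallyEq (by
    filter_upwards [eventually_slice_fst hs.isOpen hu] with s hs'
    refine hs.shapeOperator_axis hM hc hs' _ ?_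
    rw [hs.stripChart_axis hs']
    exact inner_wedge_left _ _))
  rw [hs.shapeOperator_axis hM hc hu _ (by
    rw [hs.stripChart_axis hu]
    exact hc.inner_normal_deriv_conormal hM hu')] at h3
  exact add_right_cancel (h3.trans (add_comm _ _))

/-- Codazzi exchanges the `v`-derivative on `α_u = T` for the `u`-derivative on `α_v = B`. -/
theorem fderiv_shape_snd_tangent (hs : IsStrip M N l c h U) (hM : IsOrientedSurface M N)
    (hc : IsUmbilicCurve M N l c) {u : ℝ} (hu : (u, 0) ∈ U) :
    fderiv ℝ (fun y => shapeOperator N (stripChart N c h y)) (u, 0) (0, 1) (deriv c u) =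
      deriv (curvatureAlong N c) u • conormal N c u := by
  rw [← hs.fderiv_shape_fst_conormal hM hc hu, ← hs.fderiv_fst_axis hM hc hu,
    (hs.isPatch hM hc).codazzi hu, hs.fderiv_snd_axis hM hc hu]

/-- Differentiate `⟨S α_v, α_v⟩ = h_vv ⟨N, N(c)⟩` in `v` on the axis. There `α_vv` is normal, so it
contributes nothing on the left, and `N_v` is tangent, so only `h_vvv` survives on the right. -/
theorem inner_fderiv_shape_snd_conormal (hs : IsStrip M N l c h U) (hM : IsOrientedSurface M N)
    (hc : IsUmbilicCurve M N l c) {u : ℝ} (hu : (u, 0) ∈ U) :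
    inner ℝ (fderiv ℝ (fun y => shapeOperator N (stripChart N c h y)) (u, 0) (0, 1)
      (conormal N c u)) (conormal N c u) = cubicCoeff h u := by
  have hp := hs.isPatch hM hc
  obtain ⟨-, hb, hn, -, -, hbn⟩ := orthonormal_vec3_iff.1 (hc.orthonormal hM (hs.mem_Ioo _ hu))
  dsimp only at hb hn hbn
  have hnb : inner ℝ (N (c u)) (conormal N c u) = 0 := by rw [real_inner_comm, hbn]
  have hA := hasDerivAt_slice_snd (hp.smooth_shape.differentiableAt_of_isOpen hs.isOpen hu)
  have hX := hasDerivAt_slice_snd ((hp.smooth.fderiv_const_apply hs.isOpen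
    (0, 1)).differentiableAt_of_isOpen hs.isOpen hu)
  have hn' := hasDerivAt_slice_snd (hp.smooth_normal.differentiableAt_of_isOpen hs.isOpen hu)
  have h1 := (hA.clm_apply hX).inner ℝ hX
  have h2 := (hasDerivAt_slice_snd (hs.differentiableAt_snd_snd hu)).mul
    (hn'.inner ℝ (hasDerivAt_const (0 : ℝ) (N (c u))))
  have h3 := h1.unique (h2.congr_of_eventuallyEq (by
    filter_upwards [eventually_slice_snd hs.isOpen hu] with s hs'
    exact hs.inner_shapeOperator_snd hM hc hs'))
  rw [(hp.hasFDerivAt_normal _ hu).fderiv, hs.fderiv_stripChart_snd_snd hM hc hu,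
    hs.cubicCoeff_eq hu] at h3
  simp only [neg_apply, ContinuousLinearMap.comp_apply, hs.fderiv_snd_axis hM hc hu, map_smul,
    inner_zero_right, zero_add] at h3
  rw [hs.shapeOperator_axis hM hc hu (conormal N c u) (by rw [hs.stripChart_axis hu, hnb]),
    hs.stripChart_axis hu, shapeOperator_normal hn] at h3
  simp only [inner_add_left, inner_smul_left, inner_smul_right, inner_neg_left, hbn,
    smul_zero, inner_zero_left, real_inner_self_eq_norm_sq, hn] at h3
  simpa using h3

end IsStrip

end UmbilicCurve

/-! ### Existence of the strip chart and of smooth coordinates around it. -/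

namespace UmbilicCurve

variable {M : Set E3} {N : E3 → E3} {l : ℝ} {c : ℝ → E3}

/-- The inverse function theorem for maps that are smooth on an open set of a finite-dimensional
space. -/
theorem exists_smooth_local_inverse_of_injective {E F : Type*} [NormedAddCommGroup E]
    [NormedSpace ℝ E] [FiniteDimensional ℝ E] [NormedAddCommGroup F] [NormedSpace ℝ F]
    [FiniteDimensional ℝ F] (hEF : Module.finrank ℝ E = Module.finrank ℝ F)
    {f : E → F} {a : E} {U : Set E} (hU : IsOpen U) (ha : a ∈ U) (hf : ContDiffOn ℝ ∞ f U)
    (hinj : ∀ w, fderiv ℝ f a w = 0 → w = 0) :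
    ∃ e : OpenPartialHomeomorph E F, a ∈ e.source ∧ e.source ⊆ U ∧ (∀ x, e x = f x) ∧
      ContDiffOn ℝ ∞ e.symm e.target := by
  have : CompleteSpace E := FiniteDimensional.complete ℝ E
  let g : E ≃ₗ[ℝ] F := LinearEquiv.ofInjectiveOfFinrankEq (fderiv ℝ f a : E →ₗ[ℝ] F)
    ((injective_iff_map_eq_zero _).2 hinj) hEF
  refine exists_smooth_local_inverse hU ha hf g.toContinuousLinearEquiv ?_
  refine ((hf.differentiableAt_of_isOpen hU ha).hasFDerivAt).congr_fderiv ?_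
  ext1 w
  rfl

theorem fderiv_tubeMap_axis (hM : IsOrientedSurface M N) (hc : IsUmbilicCurve M N l c) {u : ℝ}
    (hu : u ∈ Ioo 0 l) (z : (ℝ × ℝ) × ℝ) : fderiv ℝ (tubeMap N c) ((u, 0), 0) z =
      z.1.1 • deriv c u + z.1.2 • conormal N c u + z.2 • N (c u) := by
  have hopen : IsOpen {z : (ℝ × ℝ) × ℝ | z.1.1 ∈ Ioo 0 l} :=
    isOpen_Ioo.preimage (by fun_prop)
  have hd := ((contDiffOn_tubeMap hM hc).differentiableAt_of_isOpen hopen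
    (x := ((u, 0), 0)) hu).hasFDerivAt
  have hline : HasDerivAt (fun t : ℝ => (((u, 0), 0) : (ℝ × ℝ) × ℝ) + t • z) z 0 := by
    simpa using ((hasDerivAt_id (0 : ℝ)).smul_const z).const_add ((u, 0), 0)
  have h1 := HasFDerivAt.comp_hasDerivAt (0 : ℝ) (f := fun t : ℝ => ((u, 0), 0) + t • z)
    (l := tubeMap N c) (by simpa using hd) hline
  refine h1.unique ?_
  have hlu : HasDerivAt (fun t : ℝ => u + t * z.1.1) z.1.1 0 := by
    simpa using ((hasDerivAt_id (0 : ℝ)).mul_const z.1.1).const_add u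
  have hlv : ∀ r : ℝ, HasDerivAt (fun t : ℝ => t * r) r 0 := fun r => by
    simpa using (hasDerivAt_id (0 : ℝ)).mul_const r
  have comp : ∀ {f : ℝ → E3}, ContDiffOn ℝ ∞ f (Ioo 0 l) →
      HasDerivAt (fun t : ℝ => f (u + t * z.1.1)) (z.1.1 • deriv f u) 0 := fun {f} hf => by
    refine HasDerivAt.scomp (0 : ℝ) (g₁ := f) (h := fun t : ℝ => u + t * z.1.1) ?_ hlu
    simpa using (hf.differentiableAt_of_isOpen isOpen_Ioo hu).hasDerivAt
  have h2 := ((comp hc.contDiffOn_Ioo).add ((hlv z.1.2).smul (comp (hc.contDiffOn_conormal hM)))).add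
    ((hlv z.2).smul (comp (hc.contDiffOn_normal hM)))
  simp only [zero_mul, add_zero, zero_smul, zero_add] at h2
  refine h2.congr_of_eventuallyEq (Eventually.of_forall fun t => ?_)
  simp [tubeMap]

theorem isOpen_tube : IsOpen {z : (ℝ × ℝ) × ℝ | z.1.1 ∈ Ioo 0 l} :=
  isOpen_Ioo.preimage (by fun_prop)

/-- On the axis the differential of the tube map carries the standard basis to the orthonormal frame
`T, B, N`. -/
theorem exists_tube_inverse (hM : IsOrientedSurface M N) (hc : IsUmbilicCurve M N l c) {u : ℝ}
    (hu : u ∈ Ioo 0 l) : ∃ e : OpenPartialHomeomorph ((ℝ × ℝ) × ℝ) E3,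
      ((u, 0), 0) ∈ e.source ∧ e.source ⊆ {z | z.1.1 ∈ Ioo 0 l} ∧ (∀ x, e x = tubeMap N c x) ∧
      ContDiffOn ℝ ∞ e.symm e.target := by
  refine exists_smooth_local_inverse_of_injective (by simp) isOpen_tube hu
    (contDiffOn_tubeMap hM hc) fun z hz => ?_
  rw [fderiv_tubeMap_axis hM hc hu] at hz
  have hli := (hc.orthonormal hM hu).linearIndependent
  rw [Fintype.linearIndependent_iff] at hli
  have := hli ![z.1.1, z.1.2, z.2] (by simpa [Fin.sum_univ_three] using hz)
  ext
  · exact this 0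
  · exact this 1
  · exact this 2

theorem tubeMap_axis (u : ℝ) : tubeMap N c ((u, 0), 0) = c u := by simp [tubeMap]

/-- `π` is a smooth retraction of the open set `V` onto the coordinates of the chart `α` of
`M ∩ V`. -/
structure IsCoord (M : Set E3) (α : ℝ × ℝ → E3) (U : Set (ℝ × ℝ)) (π : E3 → ℝ × ℝ)
    (V : Set E3) : Prop where
  isOpen : IsOpen V
  smooth : ContDiffOn ℝ ∞ π V
  mapsTo : MapsTo π V U
  mapsTo_chart : MapsTo α U (M ∩ V)
  left_inv : ∀ q ∈ U, π (α q) = q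
  right_inv : ∀ p ∈ M ∩ V, α (π p) = p

namespace IsCoord

variable {α : ℝ × ℝ → E3} {U : Set (ℝ × ℝ)} {π : E3 → ℝ × ℝ} {V : Set E3}

theorem restrict (h : IsCoord M α U π V) {U' : Set (ℝ × ℝ)} (hU' : IsOpen U') (hsub : U' ⊆ U) :
    IsCoord M α U' π (V ∩ π ⁻¹' U') :=
  ⟨h.smooth.continuousOn.isOpen_inter_preimage h.isOpen hU', h.smooth.mono inter_subset_left,
    fun _ hp => hp.2, fun q hq => ⟨(h.mapsTo_chart (hsub hq)).1, (h.mapsTo_chart (hsub hq)).2, by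
      rwa [mem_preimage, h.left_inv q (hsub hq)]⟩, fun q hq => h.left_inv q (hsub hq),
    fun p hp => h.right_inv p ⟨hp.1, hp.2.1⟩⟩

theorem fderiv_comp (h : IsCoord M α U π V) (hU : IsOpen U) (hα : ContDiffOn ℝ ∞ α U) {q : ℝ × ℝ}
    (hq : q ∈ U) (w : ℝ × ℝ) : fderiv ℝ π (α q) (fderiv ℝ α q w) = w := by
  have h1 := (h.smooth.differentiableAt_of_isOpen h.isOpen (h.mapsTo_chart hq).2).hasFDerivAt.comp q
    (hα.differentiableAt_of_isOpen hU hq).hasFDerivAt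
  have h2 : π ∘ α =ᶠ[𝓝 q] id := by
    filter_upwards [hU.mem_nhds hq] with y hy using h.left_inv y hy
  have h3 := h1.unique ((hasFDerivAt_id q).congr_of_eventuallyEq h2)
  exact congrArg (fun L : ℝ × ℝ →L[ℝ] ℝ × ℝ => L w) h3

theorem injective (h : IsCoord M α U π V) (hU : IsOpen U) (hα : ContDiffOn ℝ ∞ α U) {q : ℝ × ℝ}
    (hq : q ∈ U) : Function.Injective (fderiv ℝ α q) :=
  Function.LeftInverse.injective (g := fderiv ℝ π (α q)) fun w => h.fderiv_comp hU hα hq w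

end IsCoord

/-- Implicit function theorem: in tube coordinates the surface is `F = 0`, and the derivative of `F`
in the normal direction is `μ ≠ 0`. So the surface is a graph over the `(u, v)` plane. -/
theorem exists_isStripHeight (hM : IsOrientedSurface M N) (hc : IsUmbilicCurve M N l c) {u₀ : ℝ}
    (hu₀ : u₀ ∈ Ioo 0 l) : ∃ h : ℝ × ℝ → ℝ, IsStripHeight M N c u₀ h := by
  have hp₀ : c u₀ ∈ M := hc.mem u₀ (Ioo_subset_Icc_self hu₀)
  obtain ⟨V, F, hV, hp₀V, hF, hFM, hgrad⟩ := hM.regular _ hp₀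
  obtain ⟨μ, hμ, hμF⟩ := hgrad _ ⟨hp₀, hp₀V⟩
  have hG := contDiffOn_tubeMap hM hc
  let O := {z : (ℝ × ℝ) × ℝ | z.1.1 ∈ Ioo 0 l} ∩ tubeMap N c ⁻¹' V
  have hO : IsOpen O := hG.continuousOn.isOpen_inter_preimage isOpen_tube hV
  have hz₀ : ((u₀, 0), 0) ∈ O := ⟨hu₀, by rwa [mem_preimage, tubeMap_axis]⟩
  have hFG : ContDiffOn ℝ ∞ (fun z => F (tubeMap N c z)) O :=
    hF.comp (hG.mono inter_subset_left) fun z hz => hz.2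
  have hΦ : ContDiffOn ℝ ∞ (fun z : (ℝ × ℝ) × ℝ => (z.1, F (tubeMap N c z))) O :=
    contDiffOn_fst.prodMk hFG
  obtain ⟨E, hE₀, hEO, hE, hEs⟩ := exists_smooth_local_inverse_of_injective (by simp) hO hz₀ hΦ (by
    intro w hw
    rw [DifferentiableAt.fderiv_prodMk differentiableAt_fst
      (hFG.differentiableAt_of_isOpen hO hz₀)] at hw
    have h1 : w.1 = 0 := by simpa [fderiv_fst] using congrArg Prod.fst hw
    have h2 : fderiv ℝ (fun z => F (tubeMap N c z)) ((u₀, 0), 0) w = 0 := by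
      simpa using congrArg Prod.snd hw
    have h3 := (HasFDerivAt.comp ((u₀, 0), 0) (f := tubeMap N c) (g := F)
      (hF.differentiableAt_of_isOpen hV hz₀.2).hasFDerivAt
      (hG.differentiableAt_of_isOpen isOpen_tube hu₀).hasFDerivAt).fderiv
    change fderiv ℝ (F ∘ tubeMap N c) _ w = 0 at h2
    rw [h3, ContinuousLinearMap.comp_apply, fderiv_tubeMap_axis hM hc hu₀, tubeMap_axis, hμF, h1,
      inner_add_right, inner_smul_right _ (N (c u₀)), real_inner_self_eq_norm_sq,
      hM.unit_normal _ hp₀] at h2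
    have h4 : w.2 = 0 := by simpa [hμ] using h2
    exact Prod.ext h1 h4)
  let h : ℝ × ℝ → ℝ := fun q => (E.symm (q, 0)).2
  have hfst : ∀ q, (q, (0 : ℝ)) ∈ E.target → E.symm (q, 0) = (q, h q) ∧
      F (tubeMap N c (q, h q)) = 0 := by
    intro q hq
    have h1 := E.right_inv hq
    rw [hE] at h1
    have h2 : (E.symm (q, 0)).1 = q := congrArg Prod.fst h1
    have h3 : E.symm (q, 0) = (q, h q) := Prod.ext h2 rfl
    exact ⟨h3, h3 ▸ congrArg Prod.snd h1⟩
  -- Uniqueness in the implicit function theorem: a point of `M` in the tube lies on the graph.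
  have hheight : ∀ z ∈ E.source, tubeMap N c z ∈ M → h z.1 = z.2 := by
    intro z hz hzM
    have h1 := E.left_inv hz
    rw [hE, (hFM _ (hEO hz).2).1 hzM] at h1
    exact congrArg Prod.snd h1
  -- Here `(q, 0)` plays two roles: in the target its `0` is the value of `F`, which makes `h`
  -- smooth; in the source it is the height `0`, which gives `h = 0` on the axis.
  let U : Set (ℝ × ℝ) := {q | (q, (0 : ℝ)) ∈ E.target ∩ E.source}
  have hU : IsOpen U := (E.open_target.inter E.open_source).preimage (by fun_prop)
  have hstrip : IsStrip M N l c h U := by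
    refine ⟨hU, ?_, fun q hq => (hEO hq.2).1, fun q hq => ?_, fun u hu => ?_⟩
    · exact contDiff_snd.comp_contDiffOn (hEs.comp (contDiffOn_id.prodMk contDiffOn_const)
        fun q hq => hq.1)
    · have h1 := hfst q hq.1
      have h2 := E.map_target hq.1
      rw [h1.1] at h2
      exact (hFM _ (hEO h2).2).2 h1.2
    · exact hheight _ hu.2 (by
        rw [tubeMap_axis]
        exact hc.mem u (Ioo_subset_Icc_self (hEO hu.2).1))
  have hq₀ : (u₀, 0) ∈ U := by
    refine ⟨?_, hE₀⟩
    have h1 := E.map_source hE₀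
    rwa [hE, tubeMap_axis, (hFM _ hp₀V).1 hp₀] at h1
  have hax : ∀ᶠ u in 𝓝 u₀, (u, (0 : ℝ)) ∈ U := eventually_slice_fst hU hq₀
  obtain ⟨e, he₀, -, he, hes⟩ := exists_tube_inverse hM hc hu₀
  have heq₀ : e.symm (c u₀) = ((u₀, 0), 0) := by
    rw [← tubeMap_axis (N := N) (c := c) u₀, ← he]
    exact e.left_inv he₀
  have ht₀ : c u₀ ∈ e.target := by
    have := e.map_source he₀
    rwa [he, tubeMap_axis] at this
  have hcont : ContinuousAt e.symm (c u₀) := e.continuousAt_symm ht₀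
  refine ⟨h, ⟨U, hU, hq₀, hstrip.smooth⟩, ?_, ?_, ?_, ?_⟩
  · refine le_antisymm ?_ ?_
    · refine tendsto_nhdsWithin_iff.2 ⟨?_, ?_⟩
      · have := ((hstrip.contDiffOn_stripChart hM hc).continuousOn.continuousAt
          (hU.mem_nhds hq₀)).tendsto
        rwa [hstrip.stripChart_axis hq₀] at this
      · filter_upwards [hU.mem_nhds hq₀] with q hq using hstrip.mapsTo hq
    -- Every point of `M` near `c u₀` has tube coordinates close to the origin of the tube, hence
    -- lies on the graph by `hheight`.
    · intro s hs
      have h1 : ∀ᶠ z in 𝓝 (((u₀, 0), 0) : (ℝ × ℝ) × ℝ), stripChart N c h z.1 ∈ s ∧ z ∈ E.source :=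
        (continuous_fst.continuousAt.eventually (mem_map.1 hs)).and (E.open_source.mem_nhds hE₀)
      rw [← heq₀] at h1
      filter_upwards [mem_nhdsWithin_of_mem_nhds (hcont.eventually h1), self_mem_nhdsWithin,
        mem_nhdsWithin_of_mem_nhds (e.open_target.mem_nhds ht₀)] with p hp hpM hpt
      have h2 : tubeMap N c (e.symm p) = p := by rw [← he, e.right_inv hpt]
      have h3 := hp.1
      rwa [stripChart_eq_tubeMap, hheight _ hp.2 (by rwa [h2]), Prod.mk.eta, h2] at h3
  · filter_upwards [hax] with u hu using hstrip.zero u hu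
  · filter_upwards [hax] with u hu
    rw [hstrip.deriv_height_slice hu, hstrip.fderiv_height_axis hM hc hu]
  · filter_upwards [hax] with u hu
    have := hstrip.iteratedDeriv_two_height hu
    dsimp only at this
    rw [this, hstrip.fderiv_fderiv_height_axis hM hc hu]

/-- The chart is a graph in tube coordinates, so the first two tube coordinates invert it and are
smooth in the ambient space. -/
theorem IsStripHeight.exists_isCoord (hM : IsOrientedSurface M N) (hc : IsUmbilicCurve M N l c)
    {u₀ : ℝ} (hu₀ : u₀ ∈ Ioo 0 l) {h : ℝ × ℝ → ℝ} (hh : IsStripHeight M N c u₀ h) :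
    ∃ (U : Set (ℝ × ℝ)) (π : E3 → ℝ × ℝ) (V : Set E3), (u₀, 0) ∈ U ∧ IsStrip M N l c h U ∧
      IsCoord M (stripChart N c h) U π V := by
  obtain ⟨U₁, hU₁, hq₁, hh₁⟩ := hh.smooth
  obtain ⟨e, he₀, heI, he, hes⟩ := exists_tube_inverse hM hc hu₀
  have h0 : h (u₀, 0) = 0 := hh.zero.self_of_nhds
  have hhc : ContinuousAt h (u₀, 0) := hh₁.continuousOn.continuousAt (hU₁.mem_nhds hq₁)
  have hgr : ∀ᶠ q in 𝓝 (u₀, (0 : ℝ)), (q, h q) ∈ e.source :=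
    (continuousAt_id.prodMk hhc).eventually 
      (e.open_source.mem_nhds (by simpa [h0] using he₀))
  have hM' : ∀ᶠ q in 𝓝 (u₀, (0 : ℝ)), stripChart N c h q ∈ M :=
    (tendsto_nhdsWithin_iff.1 (le_of_eq hh.chart : Tendsto _ _ _)).2
  have hz : ∀ᶠ q in 𝓝 (u₀, (0 : ℝ)), h (q.1, 0) = 0 :=
    (continuous_fst.tendsto (u₀, (0 : ℝ))).eventually (p := fun u => h (u, 0) = 0) hh.zero
  obtain ⟨U₂, hU₂, hU₂o, hq₂⟩ := eventually_nhds_iff.1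
    ((hU₁.eventually_mem hq₁).and (hgr.and (hM'.and hz)))
  have hs : IsStrip M N l c h U₂ := ⟨hU₂o, hh₁.mono fun q hq => (hU₂ q hq).1,
    fun q hq => heI (hU₂ q hq).2.1, fun q hq => (hU₂ q hq).2.2.1, fun u hu => (hU₂ _ hu).2.2.2⟩
  -- The filter equality makes the chart cover all of `M` near `c u₀`, excluding other sheets.
  have himg : stripChart N c h '' U₂ ∈ 𝓝[M] (c u₀) := by
    rw [← hh.chart]
    exact image_mem_map (hU₂o.mem_nhds hq₂)
  obtain ⟨V₁, hV₁, hp₁, hV₁i⟩ := mem_nhdsWithin.1 himg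
  have hleft : ∀ q ∈ U₂, stripChart N c h q ∈ e.target ∧ (e.symm (stripChart N c h q)).1 = q := by
    intro q hq
    have h1 := (hU₂ q hq).2.1
    rw [stripChart_eq_tubeMap, ← he]
    exact ⟨e.map_source h1, by rw [e.left_inv h1]⟩
  have hU : IsOpen (U₂ ∩ stripChart N c h ⁻¹' V₁) :=
    (hs.contDiffOn_stripChart hM hc).continuousOn.isOpen_inter_preimage hU₂o hV₁
  have hπ : ContDiffOn ℝ ∞ (fun p => (e.symm p).1) e.target := contDiff_fst.comp_contDiffOn hes
  refine ⟨U₂ ∩ stripChart N c h ⁻¹' V₁, fun p => (e.symm p).1,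
    (e.target ∩ (fun p => (e.symm p).1) ⁻¹' (U₂ ∩ stripChart N c h ⁻¹' V₁)) ∩ V₁,
    ⟨hq₂, by rwa [mem_preimage, hs.stripChart_axis hq₂]⟩, hs.mono hU inter_subset_left,
    (hπ.continuousOn.isOpen_inter_preimage e.open_target hU).inter hV₁,
    hπ.mono (inter_subset_left.trans inter_subset_left), fun p hp => hp.1.2, fun q hq => ?_,
    fun q hq => (hleft q hq.1).2, ?_⟩
  · refine ⟨hs.mapsTo hq.1, ⟨(hleft q hq.1).1, ?_⟩, hq.2⟩
    rw [mem_preimage, (hleft q hq.1).2]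
    exact hq
  · rintro p ⟨hpM, hpV⟩
    obtain ⟨q, hq, rfl⟩ := hV₁i ⟨hpV.2, hpM⟩
    rw [(hleft q hq).2]

end UmbilicCurve

/-! ### Adapted frames and the coefficients of the shape operator. -/

namespace UmbilicCurve

variable {M : Set E3} {N : E3 → E3} {l : ℝ} {c : ℝ → E3} {h : ℝ × ℝ → ℝ} {U : Set (ℝ × ℝ)}

/-- An orthonormal tangent frame along the chart `α`, which is the frame `T, N ∧ T` for `v = 0`. -/
structure IsFrame (N : E3 → E3) (c : ℝ → E3) (α : ℝ × ℝ → E3) (U : Set (ℝ × ℝ))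
    (e f : ℝ × ℝ → E3) : Prop where
  smooth₁ : ContDiffOn ℝ ∞ e U
  smooth₂ : ContDiffOn ℝ ∞ f U
  orthonormal : ∀ q ∈ U, Orthonormal ℝ ![e q, f q, N (α q)]
  axis₁ : ∀ u, (u, 0) ∈ U → e (u, 0) = deriv c u
  axis₂ : ∀ u, (u, 0) ∈ U → f (u, 0) = conormal N c u

theorem IsFrame.mono {α : ℝ × ℝ → E3} {e f : ℝ × ℝ → E3} (hf : IsFrame N c α U e f)
    {U' : Set (ℝ × ℝ)} (hsub : U' ⊆ U) : IsFrame N c α U' e f :=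
  ⟨hf.smooth₁.mono hsub, hf.smooth₂.mono hsub, fun q hq => hf.orthonormal q (hsub hq),
    fun u hu => hf.axis₁ u (hsub hu), fun u hu => hf.axis₂ u (hsub hu)⟩

/-- Project `c'(u)` to the tangent plane at `α(u,v)`, normalize, and complete with the vector
product. On the axis the projection changes nothing, so it is nonzero nearby. -/
theorem IsStrip.exists_frame (hs : IsStrip M N l c h U) (hM : IsOrientedSurface M N)
    (hc : IsUmbilicCurve M N l c) {u₀ : ℝ} (hu₀ : (u₀, 0) ∈ U) :
    ∃ (U' : Set (ℝ × ℝ)) (e f : ℝ × ℝ → E3), IsOpen U' ∧ U' ⊆ U ∧ (u₀, 0) ∈ U' ∧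
      IsFrame N c (stripChart N c h) U' e f := by
  have hp := hs.isPatch hM hc
  let n : ℝ × ℝ → E3 := fun q => N (stripChart N c h q)
  have hn : ContDiffOn ℝ ∞ n U := hp.smooth_normal
  have hT : ContDiffOn ℝ ∞ (fun q : ℝ × ℝ => deriv c q.1) U :=
    hc.contDiffOn_deriv.comp contDiffOn_fst hs.mem_Ioo
  let w : ℝ × ℝ → E3 := fun q => deriv c q.1 - inner ℝ (n q) (deriv c q.1) • n q
  have hw : ContDiffOn ℝ ∞ w U := hT.sub ((hn.inner ℝ hT).smul hn)
  have hwax : ∀ u, (u, 0) ∈ U → w (u, 0) = deriv c u := fun u hu => by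
    simp [w, n, hs.stripChart_axis hu, hc.inner_normal_deriv hM (hs.mem_Ioo _ hu)]
  let U' := U ∩ w ⁻¹' {0}ᶜ
  have hwU' : ∀ q ∈ U', ‖w q‖ ≠ 0 := fun q hq => norm_ne_zero_iff.2 hq.2
  have he : ContDiffOn ℝ ∞ (fun q => ‖w q‖⁻¹ • w q) U' :=
    (((hw.mono inter_subset_left).norm ℝ fun q hq => hq.2).inv hwU').smul
      (hw.mono inter_subset_left)
  have hax : ∀ u, (u, 0) ∈ U' → ‖w (u, 0)‖⁻¹ • w (u, 0) = deriv c u := fun u hu => by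
    rw [hwax u hu.1, hc.unit_speed u (hs.mem_Ioo _ hu.1), inv_one, one_smul]
  refine ⟨U', fun q => ‖w q‖⁻¹ • w q, fun q => wedge (n q) (‖w q‖⁻¹ • w q),
    hw.continuousOn.isOpen_inter_preimage hs.isOpen isOpen_compl_singleton, inter_subset_left,
    ⟨hu₀, ?_⟩, he, (hn.mono inter_subset_left).wedge he, fun q hq => ?_, hax, fun u hu => ?_⟩
  · rw [mem_preimage, hwax u₀ hu₀, mem_compl_singleton_iff, ← norm_ne_zero_iff,
      hc.unit_speed u₀ (hs.mem_Ioo _ hu₀)]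
    exact one_ne_zero
  · refine orthonormal_wedge ?_ (hp.unit_normal q hq.1) ?_
    · rw [norm_smul, norm_inv, norm_norm, inv_mul_cancel₀ (hwU' q hq)]
    · have h1 : ‖n q‖ = 1 := hp.unit_normal q hq.1
      have h2 : inner ℝ (n q) (w q) = 0 := by
        simp [w, inner_sub_right, inner_smul_right, h1]
      rw [inner_smul_right, h2, mul_zero]
  · rw [hax u hu]
    simp [n, hs.stripChart_axis hu.1, conormal]

/-- The coefficients of the shape operator along a chart. -/
noncomputable def shapeEntry (N : E3 → E3) (α : ℝ × ℝ → E3) (e f : ℝ × ℝ → E3) (q : ℝ × ℝ) : ℝ :=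
  inner ℝ (shapeOperator N (α q) (e q)) (f q)

namespace IsStrip

variable {e f : ℝ × ℝ → E3}

theorem contDiffOn_shapeEntry (hs : IsStrip M N l c h U) (hM : IsOrientedSurface M N)
    (hc : IsUmbilicCurve M N l c) (he : ContDiffOn ℝ ∞ e U) (hf : ContDiffOn ℝ ∞ f U) :
    ContDiffOn ℝ ∞ (shapeEntry N (stripChart N c h) e f) U :=
  ((hs.isPatch hM hc).smooth_shape.clm_apply he).inner ℝ hf

theorem shapeEntry_axis (hs : IsStrip M N l c h U) (hM : IsOrientedSurface M N)
    (hc : IsUmbilicCurve M N l c)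
    (hne : ∀ q ∈ U, inner ℝ (N (stripChart N c h q)) (e q) = 0) {r : ℝ}
    (hef : ∀ q ∈ U, inner ℝ (e q) (f q) = r) {u : ℝ} (hu : (u, 0) ∈ U) :
    shapeEntry N (stripChart N c h) e f (u, 0) = curvatureAlong N c u * r := by
  rw [shapeEntry, hs.shapeOperator_axis hM hc hu _ (hne _ hu), inner_smul_left, hef _ hu,
    conj_trivial]

theorem fderiv_shapeEntry_fst (hs : IsStrip M N l c h U) (hM : IsOrientedSurface M N)
    (hc : IsUmbilicCurve M N l c) (he : ContDiffOn ℝ ∞ e U) (hf : ContDiffOn ℝ ∞ f U)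
    (hne : ∀ q ∈ U, inner ℝ (N (stripChart N c h q)) (e q) = 0) {r : ℝ}
    (hef : ∀ q ∈ U, inner ℝ (e q) (f q) = r) {u : ℝ} (hu : (u, 0) ∈ U) :
    fderiv ℝ (shapeEntry N (stripChart N c h) e f) (u, 0) (1, 0) =
      deriv (curvatureAlong N c) u * r := by
  refine (hasDerivAt_slice_fst ((hs.contDiffOn_shapeEntry hM hc he
    hf).differentiableAt_of_isOpen hs.isOpen hu)).unique
    (((hs.differentiableAt_curvatureAlong hM hc hu).hasDerivAt.mul_const r).congr_of_eventuallyEq ?_)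
  filter_upwards [eventually_slice_fst hs.isOpen hu] with s hs'
  exact hs.shapeEntry_axis hM hc hne hef hs'

theorem fderiv_shapeEntry_snd (hs : IsStrip M N l c h U) (hM : IsOrientedSurface M N)
    (hc : IsUmbilicCurve M N l c) (he : ContDiffOn ℝ ∞ e U) (hf : ContDiffOn ℝ ∞ f U)
    (hne : ∀ q ∈ U, inner ℝ (N (stripChart N c h q)) (e q) = 0)
    (hnf : ∀ q ∈ U, inner ℝ (N (stripChart N c h q)) (f q) = 0) {r : ℝ}
    (hef : ∀ q ∈ U, inner ℝ (e q) (f q) = r) {u : ℝ} (hu : (u, 0) ∈ U) :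
    fderiv ℝ (shapeEntry N (stripChart N c h) e f) (u, 0) (0, 1) =
      inner ℝ (fderiv ℝ (fun y => shapeOperator N (stripChart N c h y)) (u, 0) (0, 1) (e (u, 0)))
        (f (u, 0)) :=
  (hs.isPatch hM hc).fderiv_inner_shapeOperator hu (hs.shapeOperator_axis hM hc hu)
    (he.differentiableAt_of_isOpen hs.isOpen hu) (hf.differentiableAt_of_isOpen hs.isOpen hu)
    (hne _ hu) (hnf _ hu) ((hs.isOpen.eventually_mem hu).mono hef) _

end IsStrip

/-- Recovers the values of a Hadamard quotient on the axis from the `v`-derivative of the original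
function. -/
theorem eventually_snd_mul_axis {F g : ℝ × ℝ → ℝ} (hg : ContDiff ℝ ∞ g) {u₀ : ℝ}
    (hFg : ∀ᶠ q in 𝓝 (u₀, 0), F q = q.2 * g q) :
    ∀ᶠ u in 𝓝 u₀, fderiv ℝ F (u, 0) (0, 1) = g (u, 0) := by
  have h1 : Tendsto (fun u : ℝ => (u, (0 : ℝ))) (𝓝 u₀) (𝓝 (u₀, 0)) :=
    (Continuous.prodMk_left (0 : ℝ)).tendsto u₀
  filter_upwards [h1.eventually (eventually_eventually_nhds.2 hFg)] with u hu
  have h2 : HasFDerivAt (fun q : ℝ × ℝ => q.2 * g q) _ (u, 0) :=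
    hasFDerivAt_snd.mul (hg.differentiable (by simp) (u, 0)).hasFDerivAt
  rw [(h2.congr_of_eventuallyEq hu).fderiv]
  simp

namespace IsFrame

variable {α : ℝ × ℝ → E3} {e f : ℝ × ℝ → E3}

theorem inner_normal₁ (hF : IsFrame N c α U e f) : ∀ q ∈ U, inner ℝ (N (α q)) (e q) = 0 :=
  fun q hq => by
    rw [real_inner_comm]
    exact (orthonormal_vec3_iff.1 (hF.orthonormal q hq)).2.2.2.2.1

theorem inner_normal₂ (hF : IsFrame N c α U e f) : ∀ q ∈ U, inner ℝ (N (α q)) (f q) = 0 :=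
  fun q hq => by
    rw [real_inner_comm]
    exact (orthonormal_vec3_iff.1 (hF.orthonormal q hq)).2.2.2.2.2

theorem inner₁₁ (hF : IsFrame N c α U e f) : ∀ q ∈ U, inner ℝ (e q) (e q) = (1 : ℝ) :=
  fun q hq => by
    rw [real_inner_self_eq_norm_sq, (orthonormal_vec3_iff.1 (hF.orthonormal q hq)).1, one_pow]

theorem inner₂₂ (hF : IsFrame N c α U e f) : ∀ q ∈ U, inner ℝ (f q) (f q) = (1 : ℝ) :=
  fun q hq => by
    rw [real_inner_self_eq_norm_sq, (orthonormal_vec3_iff.1 (hF.orthonormal q hq)).2.1, one_pow]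

theorem inner₁₂ (hF : IsFrame N c α U e f) : ∀ q ∈ U, inner ℝ (e q) (f q) = (0 : ℝ) :=
  fun q hq => (orthonormal_vec3_iff.1 (hF.orthonormal q hq)).2.2.2.1

theorem meanCurvature_eq (hF : IsFrame N c α U e f) {q : ℝ × ℝ} (hq : q ∈ U) :
    meanCurvature N (α q) = 1 / 2 * (shapeEntry N α e e q + shapeEntry N α f f q) := by
  rw [meanCurvature, trace_eq_of_orthonormal (hF.orthonormal q hq), ContinuousLinearMap.coe_coe,
    shapeOperator_normal (orthonormal_vec3_iff.1 (hF.orthonormal q hq)).2.2.1, inner_zero_right,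
    add_zero, shapeEntry, shapeEntry, real_inner_comm, real_inner_comm (f q)]

/-- Along the axis both diagonal entries equal `k`. Across it, `⟨S_v T, T⟩ = k' ⟨B, T⟩ = 0` and
`⟨S_v B, B⟩ = a`. -/
theorem hasFDerivAt_meanCurvature (hF : IsFrame N c (stripChart N c h) U e f)
    (hs : IsStrip M N l c h U) (hM : IsOrientedSurface M N) (hc : IsUmbilicCurve M N l c) {u : ℝ}
    (hu : (u, 0) ∈ U) :
    HasFDerivAt (fun q : ℝ × ℝ => meanCurvature N (stripChart N c h q))
      (deriv (curvatureAlong N c) u • ContinuousLinearMap.fst ℝ ℝ ℝ +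
        (cubicCoeff h u / 2) • ContinuousLinearMap.snd ℝ ℝ ℝ) (u, 0) := by
  have h1 := ((hs.contDiffOn_shapeEntry hM hc hF.smooth₁ hF.smooth₁).differentiableAt_of_isOpen
    hs.isOpen hu).hasFDerivAt
  have h2 := ((hs.contDiffOn_shapeEntry hM hc hF.smooth₂ hF.smooth₂).differentiableAt_of_isOpen
    hs.isOpen hu).hasFDerivAt
  have h3 := ((h1.add h2).const_mul (1 / 2)).congr_of_eventuallyEq
    (f₁ := fun q : ℝ × ℝ => meanCurvature N (stripChart N c h q)) (by
      filter_upwards [hs.isOpen.mem_nhds hu] with q hq using hF.meanCurvature_eq hq)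
  refine h3.congr_fderiv ?_
  have hTB : inner ℝ (conormal N c u) (deriv c u) = 0 := by
    rw [real_inner_comm]
    exact inner_wedge_right _ _
  ext
  · simp [hs.fderiv_shapeEntry_fst hM hc hF.smooth₁ hF.smooth₁ hF.inner_normal₁ hF.inner₁₁ hu,
      hs.fderiv_shapeEntry_fst hM hc hF.smooth₂ hF.smooth₂ hF.inner_normal₂ hF.inner₂₂ hu]
    ring
  · simp [hs.fderiv_shapeEntry_snd hM hc hF.smooth₁ hF.smooth₁ hF.inner_normal₁ hF.inner_normal₁
        hF.inner₁₁ hu,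
      hs.fderiv_shapeEntry_snd hM hc hF.smooth₂ hF.smooth₂ hF.inner_normal₂ hF.inner_normal₂
        hF.inner₂₂ hu, hF.axis₁ u hu, hF.axis₂ u hu, hs.fderiv_shape_snd_tangent hM hc hu,
      hs.inner_fderiv_shape_snd_conormal hM hc hu, inner_smul_left, hTB]
    ring

/-- The traceless part of the shape operator, divided by `v`. -/
theorem exists_coefficients (hF : IsFrame N c (stripChart N c h) U e f)
    (hs : IsStrip M N l c h U) (hM : IsOrientedSurface M N) (hc : IsUmbilicCurve M N l c) {u₀ : ℝ}
    (hu₀ : (u₀, 0) ∈ U) :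
    ∃ p r : ℝ × ℝ → ℝ, ContDiff ℝ ∞ p ∧ ContDiff ℝ ∞ r ∧
      (∀ᶠ q in 𝓝 (u₀, 0), shapeEntry N (stripChart N c h) e e q -
        shapeEntry N (stripChart N c h) f f q = q.2 * p q ∧
        shapeEntry N (stripChart N c h) e f q = q.2 * r q) ∧
      ∀ᶠ u in 𝓝 u₀, p (u, 0) = -cubicCoeff h u ∧ r (u, 0) = deriv (curvatureAlong N c) u := by
  have h11 := hs.contDiffOn_shapeEntry hM hc hF.smooth₁ hF.smooth₁
  have h22 := hs.contDiffOn_shapeEntry hM hc hF.smooth₂ hF.smooth₂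
  have h12 := hs.contDiffOn_shapeEntry hM hc hF.smooth₁ hF.smooth₂
  obtain ⟨p, hp, hpe⟩ := exists_contDiff_eq_snd_mul hs.isOpen hu₀ (h11.sub h22) (fun u hu => by
    rw [hs.shapeEntry_axis hM hc hF.inner_normal₁ hF.inner₁₁ hu,
      hs.shapeEntry_axis hM hc hF.inner_normal₂ hF.inner₂₂ hu, sub_self])
  obtain ⟨r, hr, hre⟩ := exists_contDiff_eq_snd_mul hs.isOpen hu₀ h12 (fun u hu => by
    rw [hs.shapeEntry_axis hM hc hF.inner_normal₁ hF.inner₁₂ hu, mul_zero])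
  refine ⟨p, r, hp, hr, hpe.and hre, ?_⟩
  filter_upwards [eventually_snd_mul_axis hp hpe, eventually_snd_mul_axis hr hre,
    eventually_slice_fst hs.isOpen hu₀] with u hup hur hu
  -- The two values are `⟨S_v T, T⟩ - ⟨S_v B, B⟩ = 0 - a` and `⟨S_v T, B⟩ = k'`.
  rw [← hup, ← hur, fderiv_fun_sub (h11.differentiableAt_of_isOpen hs.isOpen hu)
    (h22.differentiableAt_of_isOpen hs.isOpen hu), sub_apply,
    hs.fderiv_shapeEntry_snd hM hc hF.smooth₁ hF.smooth₁ hF.inner_normal₁ hF.inner_normal₁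
      hF.inner₁₁ hu,
    hs.fderiv_shapeEntry_snd hM hc hF.smooth₂ hF.smooth₂ hF.inner_normal₂ hF.inner_normal₂
      hF.inner₂₂ hu,
    hs.fderiv_shapeEntry_snd hM hc hF.smooth₁ hF.smooth₂ hF.inner_normal₁ hF.inner_normal₂
      hF.inner₁₂ hu, hF.axis₁ u hu, hF.axis₂ u hu, hs.fderiv_shape_snd_tangent hM hc hu,
    hs.inner_fderiv_shape_snd_conormal hM hc hu, inner_smul_left, inner_smul_left,
    real_inner_self_eq_norm_sq,
    (orthonormal_vec3_iff.1 (hc.orthonormal hM (hs.mem_Ioo _ hu))).2.1,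
    real_inner_comm, show inner ℝ (deriv c u) (conormal N c u) = 0 from inner_wedge_right _ _]
  simp

end IsFrame

end UmbilicCurve

/-! ### Smooth eigenvectors and principal vectors in a frame. -/

namespace UmbilicCurve

variable {M : Set E3} {N : E3 → E3} {l : ℝ} {c : ℝ → E3} {h : ℝ × ℝ → ℝ} {U : Set (ℝ × ℝ)}

/-- A smooth family of nonzero traceless symmetric `2 × 2` matrices has locally a smooth
eigenvector. -/
theorem exists_smooth_eigenvector {p r : ℝ × ℝ → ℝ} (hp : ContDiff ℝ ∞ p) (hr : ContDiff ℝ ∞ r)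
    {q₀ : ℝ × ℝ} (h0 : p q₀ ≠ 0 ∨ r q₀ ≠ 0) :
    ∃ (U : Set (ℝ × ℝ)) (R x y : ℝ × ℝ → ℝ), IsOpen U ∧ q₀ ∈ U ∧ ContDiffOn ℝ ∞ x U ∧
      ContDiffOn ℝ ∞ y U ∧ ∀ q ∈ U, (p q ≠ 0 ∨ r q ≠ 0) ∧ (x q ≠ 0 ∨ y q ≠ 0) ∧
        p q * x q + r q * y q = R q * x q ∧ r q * x q - p q * y q = R q * y q := by
  have hpos : ∀ q, p q ≠ 0 ∨ r q ≠ 0 ↔ p q ^ 2 + r q ^ 2 ≠ 0 := by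
    intro q
    rw [← not_and_or, not_iff_not]
    constructor
    · rintro ⟨h1, h2⟩
      simp [h1, h2]
    · intro h1
      have h2 : p q ^ 2 = 0 := by linarith [sq_nonneg (p q), sq_nonneg (r q)]
      have h3 : r q ^ 2 = 0 := by linarith
      exact ⟨pow_eq_zero_iff two_ne_zero |>.1 h2, pow_eq_zero_iff two_ne_zero |>.1 h3⟩
  let D : Set (ℝ × ℝ) := {q | p q ^ 2 + r q ^ 2 ≠ 0}
  have hD : IsOpen D :=
    isOpen_compl_singleton.preimage ((hp.continuous.pow 2).add (hr.continuous.pow 2))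
  let R : ℝ × ℝ → ℝ := fun q => √(p q ^ 2 + r q ^ 2)
  have hR : ContDiffOn ℝ ∞ R D := ((hp.pow 2).add (hr.pow 2)).contDiffOn.sqrt fun q hq => hq
  have hRsq : ∀ q, R q ^ 2 = p q ^ 2 + r q ^ 2 := fun q => Real.sq_sqrt (by positivity)
  have hq₀ : q₀ ∈ D := (hpos q₀).1 h0
  -- For the eigenvalue `R = √(p² + r²) > 0` both `(p + R, r)` and `(r, R - p)` are eigenvectors
  -- where nonzero. The functions `p + R` and `R - p` cannot vanish together, and the one nonzero at
  -- `q₀` decides the choice.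
  by_cases hc : p q₀ + R q₀ = 0
  · have hx : ContDiffOn ℝ ∞ (fun q => R q - p q) D := hR.sub hp.contDiffOn
    have hne : R q₀ - p q₀ ≠ 0 := fun h1 => hq₀ (by
      have h2 : R q₀ = 0 := by linarith
      rw [← hRsq, h2, zero_pow two_ne_zero])
    refine ⟨D ∩ (fun q => R q - p q) ⁻¹' {0}ᶜ, R, r, fun q => R q - p q,
      hx.continuousOn.isOpen_inter_preimage hD isOpen_compl_singleton, ⟨hq₀, hne⟩, hr.contDiffOn,
      hx.mono inter_subset_left, fun q hq => ⟨(hpos q).2 hq.1, Or.inr hq.2, by ring, ?_⟩⟩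
    linear_combination -hRsq q
  · have hx : ContDiffOn ℝ ∞ (fun q => p q + R q) D := hp.contDiffOn.add hR
    refine ⟨D ∩ (fun q => p q + R q) ⁻¹' {0}ᶜ, R, fun q => p q + R q, r,
      hx.continuousOn.isOpen_inter_preimage hD isOpen_compl_singleton, ⟨hq₀, hc⟩,
      hx.mono inter_subset_left, hr.contDiffOn,
      fun q hq => ⟨(hpos q).2 hq.1, Or.inl hq.2, ?_, by ring⟩⟩
    linear_combination -hRsq q

namespace IsFrame

variable {α : ℝ × ℝ → E3} {e f : ℝ × ℝ → E3} {q : ℝ × ℝ}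

theorem shapeOperator₁ (hF : IsFrame N c α U e f) (hp : IsPatch N α U) (hq : q ∈ U)
    (hinj : Function.Injective (fderiv ℝ α q)) : shapeOperator N (α q) (e q) =
      shapeEntry N α e e q • e q + shapeEntry N α e f q • f q := by
  have h1 := eq_sum_of_orthonormal (hF.orthonormal q hq) (shapeOperator N (α q) (e q))
  rw [hp.inner_normal_shapeOperator hq hinj (hF.inner_normal₁ q hq), zero_smul, add_zero] at h1
  rw [shapeEntry, shapeEntry, real_inner_comm, real_inner_comm (f q)]
  exact h1

theorem shapeOperator₂ (hF : IsFrame N c α U e f) (hp : IsPatch N α U) (hq : q ∈ U)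
    (hinj : Function.Injective (fderiv ℝ α q)) : shapeOperator N (α q) (f q) =
      shapeEntry N α e f q • e q + shapeEntry N α f f q • f q := by
  have h1 := eq_sum_of_orthonormal (hF.orthonormal q hq) (shapeOperator N (α q) (f q))
  rw [hp.inner_normal_shapeOperator hq hinj (hF.inner_normal₂ q hq), zero_smul, add_zero] at h1
  rw [shapeEntry, shapeEntry, hp.inner_shapeOperator_comm hq hinj (hF.inner_normal₁ q hq)
    (hF.inner_normal₂ q hq), real_inner_comm (e q), real_inner_comm (f q)]
  exact h1

theorem comb_ne_zero (hF : IsFrame N c α U e f) (hq : q ∈ U) {x y : ℝ} (hxy : x ≠ 0 ∨ y ≠ 0) :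
    x • e q + y • f q ≠ 0 := by
  intro h0
  have h1 := congrArg (inner ℝ (e q)) h0
  have h2 := congrArg (inner ℝ (f q)) h0
  rw [inner_add_right, inner_smul_right, inner_smul_right, hF.inner₁₁ q hq, hF.inner₁₂ q hq,
    inner_zero_right] at h1
  rw [inner_add_right, inner_smul_right, inner_smul_right, hF.inner₂₂ q hq, real_inner_comm,
    hF.inner₁₂ q hq, inner_zero_right] at h2
  rcases hxy with h | h
  · exact h (by linarith)
  · exact h (by linarith)

theorem inner_normal_comb (hF : IsFrame N c α U e f) (hq : q ∈ U) (x y : ℝ) :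
    inner ℝ (N (α q)) (x • e q + y • f q) = 0 := by
  simp [inner_add_right, inner_smul_right, hF.inner_normal₁ q hq, hF.inner_normal₂ q hq]

/-- Tangent vectors whose coordinates are an eigenvector of the coefficient matrix are principal. -/
theorem isPrincipalVector (hF : IsFrame N c α U e f) (hp : IsPatch N α U) (hq : q ∈ U)
    (hinj : Function.Injective (fderiv ℝ α q)) {x y κ : ℝ} (hxy : x ≠ 0 ∨ y ≠ 0)
    (h1 : shapeEntry N α e e q * x + shapeEntry N α e f q * y = κ * x)
    (h2 : shapeEntry N α e f q * x + shapeEntry N α f f q * y = κ * y) :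
    IsPrincipalVector N (α q) (x • e q + y • f q) := by
  refine ⟨hF.comb_ne_zero hq hxy, hF.inner_normal_comb hq x y, κ, ?_⟩
  rw [map_add, map_smul, map_smul, hF.shapeOperator₁ hp hq hinj, hF.shapeOperator₂ hp hq hinj]
  calc _ = (shapeEntry N α e e q * x + shapeEntry N α e f q * y) • e q +
        (shapeEntry N α e f q * x + shapeEntry N α f f q * y) • f q := by module
    _ = _ := by rw [h1, h2]; module

theorem entries_of_isUmbilic (hF : IsFrame N c α U e f) (hq : q ∈ U) (hu : IsUmbilic N (α q)) :
    shapeEntry N α e e q - shapeEntry N α f f q = 0 ∧ shapeEntry N α e f q = 0 := by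
  obtain ⟨κ, hκ⟩ := hu
  simp only [shapeEntry, hκ _ (hF.inner_normal₁ q hq), hκ _ (hF.inner_normal₂ q hq),
    inner_smul_left, hF.inner₁₁ q hq, hF.inner₂₂ q hq, hF.inner₁₂ q hq, conj_trivial]
  simp

end IsFrame

/-- A tangential vector field is transversal to `c` where its conormal component is nonzero. -/
theorem linearIndependent_of_conormal_ne_zero (hM : IsOrientedSurface M N)
    (hc : IsUmbilicCurve M N l c) {u : ℝ} (hu : u ∈ Ioo 0 l) {x y : ℝ} (hy : y ≠ 0) :
    LinearIndependent ℝ ![x • deriv c u + y • conormal N c u, deriv c u] := by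
  rw [LinearIndependent.pair_iff]
  intro s t hst
  have hli := (hc.orthonormal hM hu).linearIndependent
  rw [Fintype.linearIndependent_iff] at hli
  have h1 := hli ![s * x + t, s * y, 0] (by
    simp only [Fin.sum_univ_three, Matrix.cons_val]
    rw [← hst]
    module)
  have h2 : s * y = 0 := h1 1
  have h3 : s * x + t = 0 := h1 0
  have h4 : s = 0 := (mul_eq_zero.1 h2).resolve_right hy
  exact ⟨h4, by simpa [h4] using h3⟩

/-! ### Leaves through the curve and their order of contact. -/

section Leaf

variable {π : E3 → ℝ × ℝ} {V : Set E3} {ξ : ℝ × ℝ → E3} {u₀ : ℝ}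

theorem IsCoord.chart_fderiv {α : ℝ × ℝ → E3} (hk : IsCoord M α U π V) (hp : IsPatch N α U)
    {q : ℝ × ℝ} (hq : q ∈ U) {w : E3} (hw : inner ℝ (N (α q)) w = 0) :
    fderiv ℝ α q (fderiv ℝ π (α q) w) = w := by
  obtain ⟨z, rfl⟩ := hp.exists_fderiv_eq hq (hk.injective hp.isOpen hp.smooth hq) hw
  rw [hk.fderiv_comp hp.isOpen hp.smooth hq]

/-- Integrate the pulled-back field in the parameter plane and push the solution forward, so that
the leaf lies in `M` automatically. -/
theorem IsCoord.exists_isLeafAt {α : ℝ × ℝ → E3} (hk : IsCoord M α U π V) (hp : IsPatch N α U)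
    (hξ : ContDiffOn ℝ ∞ ξ U) (hξn : ∀ q ∈ U, inner ℝ (N (α q)) (ξ q) = 0)
    (hξ0 : ∀ q ∈ U, ξ q ≠ 0) {q₀ : ℝ × ℝ} (hq₀ : q₀ ∈ U) :
    ∃ γ, IsLeafAt M (fun p => ξ (π p)) (α q₀) γ := by
  have hY : ContDiffOn ℝ ∞ (fun q => fderiv ℝ π (α q) (ξ q)) U :=
    ((hk.smooth.fderiv_of_isOpen hk.isOpen (by simp)).comp hp.smooth
      fun q hq => (hk.mapsTo_chart hq).2).clm_apply hξ
  obtain ⟨η, h0, ε, hε, hη, hηd⟩ := exists_smooth_integral_curve hp.isOpen hY hq₀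
  refine ⟨fun t => α (η t), congrArg α h0, ε, hε, hp.smooth.comp hη fun t ht => (hηd t ht).1,
    fun t ht => ?_⟩
  obtain ⟨htU, htd⟩ := hηd t ht
  have h1 := (hp.smooth.differentiableAt_of_isOpen hp.isOpen htU).hasFDerivAt.comp_hasDerivAt t htd
  rw [hk.chart_fderiv hp htU (hξn _ htU)] at h1
  have h2 : deriv (fun t => α (η t)) t = ξ (η t) := h1.deriv
  dsimp only
  rw [h2, hk.left_inv _ htU]
  exact ⟨(hk.mapsTo_chart htU).1, hξ0 _ htU, Submodule.mem_span_singleton_self _⟩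

/-- The leaf through `c u₀` of a tangential line field that is tangent to `c` at `c u₀`, but whose
angle with `c` has a nonzero derivative there. -/
theorem IsCoord.leafHasQuadraticContact (hk : IsCoord M (stripChart N c h) U π V)
    (hs : IsStrip M N l c h U) (hM : IsOrientedSurface M N) (hc : IsUmbilicCurve M N l c)
    (hu₀ : (u₀, 0) ∈ U) (hξ : ContDiffOn ℝ ∞ ξ U)
    (hξn : ∀ q ∈ U, inner ℝ (N (stripChart N c h q)) (ξ q) = 0) (hξ0 : ∀ q ∈ U, ξ q ≠ 0)
    {x y : ℝ → ℝ} (hax : ∀ u, (u, 0) ∈ U → ξ (u, 0) = x u • deriv c u + y u • conormal N c u)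
    (hy : y u₀ = 0) {b : ℝ} (hyb : HasDerivAt y b u₀) (hb : b ≠ 0) :
    LeafHasQuadraticContact M (fun p => ξ (π p)) c u₀ := by
  have hp := hs.isPatch hM hc
  have hαc := hs.stripChart_axis hu₀
  have hπc : ∀ u, (u, 0) ∈ U → π (c u) = (u, 0) := fun u hu => by
    rw [← hs.stripChart_axis hu, hk.left_inv _ hu]
  have hπT : ∀ u, (u, 0) ∈ U → fderiv ℝ π (c u) (deriv c u) = (1, 0) := fun u hu => by
    rw [← hs.fderiv_fst_axis hM hc hu, ← hs.stripChart_axis hu,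
      hk.fderiv_comp hs.isOpen hp.smooth hu]
  have hπB : ∀ u, (u, 0) ∈ U → fderiv ℝ π (c u) (conormal N c u) = (0, 1) := fun u hu => by
    rw [← hs.fderiv_snd_axis hM hc hu, ← hs.stripChart_axis hu,
      hk.fderiv_comp hs.isOpen hp.smooth hu]
  refine ⟨hαc ▸ hk.exists_isLeafAt hp hξ hξn hξ0 hu₀, fun γ hγ => ?_⟩
  obtain ⟨hγ0, ε, hε, hγs, hγt⟩ := hγ
  have h0ε : (0 : ℝ) ∈ Ioo (-ε) ε := ⟨by linarith, hε⟩
  have hnhds : Ioo (-ε) ε ∈ 𝓝 (0 : ℝ) := isOpen_Ioo.mem_nhds h0ε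
  have hp₀V : c u₀ ∈ V := hαc ▸ (hk.mapsTo_chart hu₀).2
  have hu₀l := hs.mem_Ioo _ hu₀
  have hγ0' : ContDiffAt ℝ ∞ γ 0 := hγs.contDiffAt hnhds
  have hπ0 : ContDiffAt ℝ ∞ π (γ 0) := by
    rw [hγ0]
    exact hk.smooth.contDiffAt (hk.isOpen.mem_nhds hp₀V)
  have hγV : ∀ᶠ t in 𝓝 (0 : ℝ), t ∈ Ioo (-ε) ε ∧ γ t ∈ V :=
    (isOpen_Ioo.eventually_mem h0ε).and (hγ0'.continuousAt.eventually (by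
      rw [hγ0]
      exact hk.isOpen.mem_nhds hp₀V))
  have hγd : ∀ t ∈ Ioo (-ε) ε, HasDerivAt γ (deriv γ t) t := fun t ht =>
    (hγs.differentiableAt_of_isOpen isOpen_Ioo ht).hasDerivAt
  -- the velocity of the leaf is `μ • ξ`
  let μ : ℝ → ℝ := fun t => inner ℝ (ξ (π (γ t))) (deriv γ t) / ‖ξ (π (γ t))‖ ^ 2
  have hμ : ∀ t ∈ Ioo (-ε) ε, γ t ∈ V → deriv γ t = μ t • ξ (π (γ t)) := by
    intro t ht htV
    obtain ⟨a, ha⟩ := Submodule.mem_span_singleton.1 (hγt t ht).2.2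
    have h1 : ‖ξ (π (γ t))‖ ≠ 0 := norm_ne_zero_iff.2 (hξ0 _ (hk.mapsTo htV))
    have h2 : μ t = a := by
      simp only [μ, ← ha, inner_smul_right, real_inner_self_eq_norm_sq]
      field_simp
    rw [h2, ha]
  have hξ₀ : ξ (u₀, 0) = x u₀ • deriv c u₀ := by rw [hax u₀ hu₀, hy, zero_smul, add_zero]
  have hγ'0 : deriv γ 0 = (μ 0 * x u₀) • deriv c u₀ := by
    rw [hμ 0 h0ε (by rwa [hγ0]), hγ0, hπc u₀ hu₀, hξ₀, smul_smul]
  have hμx : μ 0 * x u₀ ≠ 0 := fun h1 => (hγt 0 h0ε).2.1 (by rw [hγ'0, h1, zero_smul])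
  have hμ0 : μ 0 ≠ 0 := left_ne_zero_of_mul hμx
  have hπγ : HasDerivAt (fun t => π (γ t)) (μ 0 * x u₀, 0) 0 := by
    have h1 := (hπ0.differentiableAt (by simp)).hasFDerivAt.comp_hasDerivAt (0 : ℝ) (hγd 0 h0ε)
    rw [hγ'0, map_smul, hγ0, hπT u₀ hu₀] at h1
    refine h1.congr_deriv ?_
    simp
  have hφd : HasDerivAt (fun t => (π (γ t)).1) (μ 0 * x u₀) 0 :=
    (ContinuousLinearMap.fst ℝ ℝ ℝ).hasFDerivAt.comp_hasDerivAt (0 : ℝ) hπγ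
  have hφ0 : (π (γ 0)).1 = u₀ := by rw [hγ0, hπc u₀ hu₀]
  constructor
  · refine ⟨fun t => (π (γ t)).1, contDiffAt_fst.comp (0 : ℝ) (hπ0.comp (0 : ℝ) hγ0'), hφ0, ?_, ?_⟩
    · rw [hφd.deriv]
      exact hμx
    · have h1 : HasDerivAt (fun t => c (π (γ t)).1) ((μ 0 * x u₀) • deriv c u₀) 0 := by
        refine HasDerivAt.scomp (0 : ℝ) (g₁ := c) (h := fun t => (π (γ t)).1) ?_ hφd
        rw [hφ0]
        exact hc.hasDerivAt hu₀l
      have h2 := (hγd 0 h0ε).sub h1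
      rw [hγ'0, sub_self, hasDerivAt_iff_isLittleO] at h2
      simpa [hφ0, hγ0, hπc u₀ hu₀] using h2
  · rintro ⟨φ, hφs, hφu, -, hφo⟩
    -- The `v`-component of the field in the parameter plane: along the leaf `v' = μ g`, and `g = y`
    -- on the axis.
    let g : ℝ × ℝ → ℝ := fun q => (fderiv ℝ π (stripChart N c h q) (ξ q)).2
    have hg : ContDiffOn ℝ ∞ g U := contDiff_snd.comp_contDiffOn
      (((hk.smooth.fderiv_of_isOpen hk.isOpen (by simp)).comp hp.smooth
        fun q hq => (hk.mapsTo_chart hq).2).clm_apply hξ)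
    have hgax : ∀ u, (u, 0) ∈ U → g (u, 0) = y u := fun u hu => by
      simp [g, hax u hu, hs.stripChart_axis hu, hπT u hu, hπB u hu]
    have hgu : fderiv ℝ g (u₀, 0) (1, 0) = b := by
      refine (hasDerivAt_slice_fst (hg.differentiableAt_of_isOpen hs.isOpen hu₀)).unique
        (hyb.congr_of_eventuallyEq ?_)
      filter_upwards [eventually_slice_fst hs.isOpen hu₀] with u hu using hgax u hu
    have hgγ : HasDerivAt (fun t => g (π (γ t))) (μ 0 * x u₀ * b) 0 := by
      have h1 := HasFDerivAt.comp_hasDerivAt (0 : ℝ) (f := fun t => π (γ t)) (l := g)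
        (l' := fderiv ℝ g (u₀, 0)) (by
          rw [hγ0, hπc u₀ hu₀]
          exact (hg.differentiableAt_of_isOpen hs.isOpen hu₀).hasFDerivAt) hπγ
      have h2 : (μ 0 * x u₀, (0 : ℝ)) = (μ 0 * x u₀) • ((1 : ℝ), (0 : ℝ)) := by simp
      rw [h2, map_smul, hgu] at h1
      exact h1
    have hμd : DifferentiableAt ℝ μ 0 := by
      have h1 : DifferentiableAt ℝ (fun t => ξ (π (γ t))) 0 :=
        DifferentiableAt.comp (0 : ℝ) (g := ξ) (f := fun t => π (γ t)) (by
          rw [hγ0, hπc u₀ hu₀]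
          exact hξ.differentiableAt_of_isOpen hs.isOpen hu₀) hπγ.differentiableAt
      have h2 : DifferentiableAt ℝ (deriv γ) 0 :=
        (hγs.deriv_of_isOpen (m := ∞) isOpen_Ioo (by simp)).differentiableAt_of_isOpen isOpen_Ioo
          h0ε
      refine (h1.inner ℝ h2).div (h1.norm_sq ℝ) ?_
      rw [hγ0, hπc u₀ hu₀]
      exact pow_ne_zero 2 (norm_ne_zero_iff.2 (hξ0 _ hu₀))
    have hβd : ∀ᶠ t in 𝓝 (0 : ℝ), HasDerivAt (fun t => (π (γ t)).2) (μ t * g (π (γ t))) t := by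
      filter_upwards [hγV] with t ht
      have h1 := (hk.smooth.differentiableAt_of_isOpen hk.isOpen ht.2).hasFDerivAt.comp_hasDerivAt
        t (hγd t ht.1)
      have h2 := (ContinuousLinearMap.snd ℝ ℝ ℝ).hasFDerivAt.comp_hasDerivAt t h1
      refine h2.congr_deriv ?_
      simp only [g, hk.right_inv _ ⟨(hγt t ht.1).1, ht.2⟩]
      rw [hμ t ht.1 ht.2, map_smul]
      rfl
    have hg0 : g (π (γ 0)) = 0 := by rw [hγ0, hπc u₀ hu₀, hgax u₀ hu₀, hy]
    -- Since `g` vanishes at the starting point, the derivative of `μ` drops out, and `v''(0) =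
    -- μ(0)² x(u₀) b`.
    have hβ'd : HasDerivAt (fun t => μ t * g (π (γ t))) (μ 0 * (μ 0 * x u₀ * b)) 0 := by
      have h1 := hμd.hasDerivAt.mul hgγ
      rw [hg0, mul_zero, zero_add] at h1
      exact h1
    refine not_isLittleO_sq_of_hasDerivAt (by rw [hγ0, hπc u₀ hu₀]) hβd
      (by rw [hg0, mul_zero]) hβ'd (mul_ne_zero hμ0 (mul_ne_zero hμx hb)) ?_
    -- Strict differentiability makes `π` Lipschitz near `c u₀`, so an `o(t²)` error in space stays
    -- `o(t²)` in coordinates. As `π (c (φ t)) = (φ t, 0)`, its second component is `v` along the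
    -- leaf, whatever `φ` is.
    have hstrict : HasStrictFDerivAt π (fderiv ℝ π (c u₀)) (c u₀) :=
      (hγ0 ▸ hπ0).hasStrictFDerivAt (by simp)
    have hcφ : Tendsto (fun t => c (φ t)) (𝓝 0) (𝓝 (c u₀)) := by
      have h1 : ContinuousAt (fun t => c (φ t)) 0 :=
        ContinuousAt.comp (g := c) (by rw [hφu]; exact (hc.hasDerivAt hu₀l).continuousAt)
          hφs.continuousAt
      have h2 := h1.tendsto
      rwa [hφu] at h2
    have hγlim : Tendsto γ (𝓝 0) (𝓝 (c u₀)) := hγ0 ▸ hγ0'.continuousAt.tendsto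
    have hO := hstrict.isBigO_sub.comp_tendsto (hγlim.prodMk_nhds hcφ)
    have ho : (fun t => π (γ t) - π (c (φ t))) =o[𝓝 0] fun t : ℝ => t ^ 2 := by
      refine (hO.trans_isLittleO hφo).congr_right ?_
      intro t
      rw [sub_zero]
    refine (IsBigO.trans_isLittleO (IsBigO.of_bound 1 ?_) ho)
    have hφU : ∀ᶠ t in 𝓝 (0 : ℝ), (φ t, (0 : ℝ)) ∈ U :=
      hφs.continuousAt.eventually (p := fun u => (u, (0 : ℝ)) ∈ U) (by
        rw [hφu]
        exact eventually_slice_fst hs.isOpen hu₀)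
    filter_upwards [hφU] with t ht
    rw [hπc _ ht, one_mul]
    have h1 := norm_snd_le (π (γ t) - (φ t, (0 : ℝ)))
    simpa using h1

end Leaf

end UmbilicCurve

/-! ### The principal foliations and the main theorem. -/

namespace UmbilicCurve

variable {M : Set E3} {N : E3 → E3} {l : ℝ} {c : ℝ → E3} {h : ℝ × ℝ → ℝ} {W : Set (ℝ × ℝ)}
  {π : E3 → ℝ × ℝ} {V : Set E3} {e f : ℝ × ℝ → E3} {u₀ : ℝ}

/-- The vector field on the surface with the given coordinates in a frame. -/
noncomputable def frameField (e f : ℝ × ℝ → E3) (x y : ℝ × ℝ → ℝ) (q : ℝ × ℝ) : E3 :=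
  x q • e q + y q • f q

theorem IsFrame.contDiffOn_frameField {α : ℝ × ℝ → E3} (hF : IsFrame N c α W e f)
    {x y : ℝ × ℝ → ℝ} (hx : ContDiffOn ℝ ∞ x W) (hy : ContDiffOn ℝ ∞ y W) :
    ContDiffOn ℝ ∞ (frameField e f x y) W := (hx.smul hF.smooth₁).add (hy.smul hF.smooth₂)

theorem IsFrame.frameField_axis {α : ℝ × ℝ → E3} (hF : IsFrame N c α W e f) (x y : ℝ × ℝ → ℝ)
    {u : ℝ} (hu : (u, 0) ∈ W) :
    frameField e f x y (u, 0) = x (u, 0) • deriv c u + y (u, 0) • conormal N c u := by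
  rw [frameField, hF.axis₁ u hu, hF.axis₂ u hu]

theorem IsFrame.isTransversalNear (hF : IsFrame N c (stripChart N c h) W e f)
    (hk : IsCoord M (stripChart N c h) W π V) (hs : IsStrip M N l c h W)
    (hM : IsOrientedSurface M N) (hc : IsUmbilicCurve M N l c) (hu₀ : (u₀, 0) ∈ W)
    (x : ℝ × ℝ → ℝ) {y : ℝ × ℝ → ℝ} (hy : ContDiffOn ℝ ∞ y W) (hy0 : y (u₀, 0) ≠ 0) :
    IsTransversalNear (fun p => frameField e f x y (π p)) c u₀ := by
  have hax : Tendsto (fun u : ℝ => (u, (0 : ℝ))) (𝓝 u₀) (𝓝 (u₀, 0)) :=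
    (Continuous.prodMk_left (0 : ℝ)).tendsto u₀
  filter_upwards [eventually_slice_fst hs.isOpen hu₀, hax.eventually
    ((hy.continuousOn.continuousAt (hs.isOpen.mem_nhds hu₀)).eventually_ne hy0)] with u hu hyu
  have h1 : π (c u) = (u, 0) := by rw [← hs.stripChart_axis hu, hk.left_inv _ hu]
  rw [h1, hF.frameField_axis x y hu]
  exact linearIndependent_of_conormal_ne_zero hM hc (hs.mem_Ioo _ hu) hyu

/-- Differentiate `p x y = r (x² - y²)` along the axis where `y = r = 0`: this gives `p x y' = r'
x²`, and `x ≠ 0`, so `y' ≠ 0`. -/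
theorem IsFrame.leafHasQuadraticContact (hF : IsFrame N c (stripChart N c h) W e f)
    (hk : IsCoord M (stripChart N c h) W π V) (hs : IsStrip M N l c h W)
    (hM : IsOrientedSurface M N) (hc : IsUmbilicCurve M N l c) (hu₀ : (u₀, 0) ∈ W)
    {p r x y : ℝ × ℝ → ℝ} (hp : ContDiff ℝ ∞ p)
    (hx : ContDiffOn ℝ ∞ x W) (hy : ContDiffOn ℝ ∞ y W) (hxy : ∀ q ∈ W, x q ≠ 0 ∨ y q ≠ 0)
    (heq : ∀ q ∈ W, p q * (x q * y q) = r q * (x q ^ 2 - y q ^ 2)) (hy0 : y (u₀, 0) = 0)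
    (hr0 : r (u₀, 0) = 0) {ρ : ℝ} (hρ : HasDerivAt (fun u => r (u, 0)) ρ u₀) (hρ0 : ρ ≠ 0) :
    LeafHasQuadraticContact M (fun p => frameField e f x y (π p)) c u₀ := by
  have hx0 : x (u₀, 0) ≠ 0 := (hxy _ hu₀).resolve_right (fun h1 => h1 hy0)
  have hdx := hasDerivAt_slice_fst (hx.differentiableAt_of_isOpen hs.isOpen hu₀)
  have hdy := hasDerivAt_slice_fst (hy.differentiableAt_of_isOpen hs.isOpen hu₀)
  have hdp := hasDerivAt_slice_fst (hp.differentiable (by simp) (u₀, 0))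
  have h1 := hdp.mul (hdx.mul hdy)
  have h2 := hρ.mul ((hdx.pow 2).sub (hdy.pow 2))
  have h3 := h1.unique (h2.congr_of_eventuallyEq (by
    filter_upwards [eventually_slice_fst hs.isOpen hu₀] with u hu using heq _ hu))
  refine hk.leafHasQuadraticContact hs hM hc hu₀ (hF.contDiffOn_frameField hx hy)
    (fun q hq => hF.inner_normal_comb hq _ _) (fun q hq => hF.comb_ne_zero hq (hxy q hq))
    (x := fun u => x (u, 0)) (y := fun u => y (u, 0)) (fun u hu => hF.frameField_axis x y hu)
    hy0 hdy fun hb => ?_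
  simp [hy0, hr0, hb, hρ0, hx0] at h3

theorem IsFrame.isPrincipalPair (hF : IsFrame N c (stripChart N c h) W e f)
    (hk : IsCoord M (stripChart N c h) W π V) (hs : IsStrip M N l c h W)
    (hM : IsOrientedSurface M N) (hc : IsUmbilicCurve M N l c) {p r R x y : ℝ × ℝ → ℝ}
    (hx : ContDiffOn ℝ ∞ x W) (hy : ContDiffOn ℝ ∞ y W)
    (hent : ∀ q ∈ W, shapeEntry N (stripChart N c h) e e q -
      shapeEntry N (stripChart N c h) f f q = q.2 * p q ∧
      shapeEntry N (stripChart N c h) e f q = q.2 * r q)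
    (heig : ∀ q ∈ W, (x q ≠ 0 ∨ y q ≠ 0) ∧ p q / 2 * x q + r q * y q = R q * x q ∧
      r q * x q - p q / 2 * y q = R q * y q) :
    IsPrincipalPair M N V (fun p => frameField e f x y (π p))
      (fun p => frameField e f (fun q => -y q) x (π p)) := by
  have hp := hs.isPatch hM hc
  have hprin : ∀ z ∈ M ∩ V, IsPrincipalVector N z (frameField e f x y (π z)) ∧
      IsPrincipalVector N z (frameField e f (fun q => -y q) x (π z)) := by
    intro z hz
    have hq : π z ∈ W := hk.mapsTo hz.2
    obtain ⟨h1, h2⟩ := hent _ hq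
    obtain ⟨hxy, h3, h4⟩ := heig _ hq
    have hinj := hk.injective hs.isOpen hp.smooth hq
    rw [← hk.right_inv z hz, hk.left_inv _ hq]
    constructor
    -- The coefficient matrix is its half trace times the identity plus `v` times `[[p/2, r], [r,
    -- -p/2]]`. So the eigenvectors are shared, with principal curvatures half trace `± v R`; the
    -- rotated vector `(-y, x)` takes the minus sign.
    · refine hF.isPrincipalVector hp hq hinj (κ := (shapeEntry N (stripChart N c h) e e (π z) +
        shapeEntry N (stripChart N c h) f f (π z)) / 2 + (π z).2 * R (π z)) hxy ?_ ?_
      · linear_combination (x (π z) / 2) * h1 + y (π z) * h2 + (π z).2 * h3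
      · linear_combination -(y (π z) / 2) * h1 + x (π z) * h2 + (π z).2 * h4
    · refine hF.isPrincipalVector hp hq hinj (κ := (shapeEntry N (stripChart N c h) e e (π z) +
        shapeEntry N (stripChart N c h) f f (π z)) / 2 - (π z).2 * R (π z))
        (hxy.symm.imp_left neg_ne_zero.2) ?_ ?_
      · linear_combination -(y (π z) / 2) * h1 + x (π z) * h2 + (π z).2 * h4
      · linear_combination -(x (π z) / 2) * h1 - y (π z) * h2 - (π z).2 * h3
  refine ⟨(hF.contDiffOn_frameField hx hy).comp hk.smooth hk.mapsTo,
    (hF.contDiffOn_frameField hy.neg hx).comp hk.smooth hk.mapsTo, fun z hz => (hprin z hz).1,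
    fun z hz => (hprin z hz).2, fun z hz => ?_⟩
  have hq : π z ∈ W := hk.mapsTo hz.2
  have hfe : inner ℝ (f (π z)) (e (π z)) = (0 : ℝ) := by
    rw [real_inner_comm, hF.inner₁₂ _ hq]
  simp only [frameField, inner_add_left, inner_add_right, inner_smul_left, inner_smul_right,
    hF.inner₁₁ _ hq, hF.inner₁₂ _ hq, hF.inner₂₂ _ hq, hfe, conj_trivial]
  ring

/-- Umbilicity means `v p = v r = 0`; as `p` and `r` have no common zero, `v = 0` and the point is
on `c`. -/
theorem IsFrame.isUmbilic_iff (hF : IsFrame N c (stripChart N c h) W e f)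
    (hk : IsCoord M (stripChart N c h) W π V) (hs : IsStrip M N l c h W)
    (hc : IsUmbilicCurve M N l c) {p r : ℝ × ℝ → ℝ}
    (hent : ∀ q ∈ W, shapeEntry N (stripChart N c h) e e q -
      shapeEntry N (stripChart N c h) f f q = q.2 * p q ∧
      shapeEntry N (stripChart N c h) e f q = q.2 * r q)
    (hpr : ∀ q ∈ W, p q ≠ 0 ∨ r q ≠ 0) : ∀ z ∈ M ∩ V, IsUmbilic N z ↔ z ∈ c '' Icc 0 l := by
  intro z hz
  constructor
  · intro hu
    have hq : π z ∈ W := hk.mapsTo hz.2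
    obtain ⟨h1, h2⟩ := hF.entries_of_isUmbilic hq (by rwa [hk.right_inv z hz])
    rw [(hent _ hq).1] at h1
    rw [(hent _ hq).2] at h2
    have h3 : (π z).2 = 0 := by
      rcases hpr _ hq with h | h
      · exact (mul_eq_zero.1 h1).resolve_right h
      · exact (mul_eq_zero.1 h2).resolve_right h
    have h4 : π z = ((π z).1, 0) := Prod.ext rfl h3
    refine ⟨(π z).1, Ioo_subset_Icc_self (hs.mem_Ioo _ hq), ?_⟩
    rw [← hs.stripChart_axis (h4 ▸ hq), ← h4, hk.right_inv z hz]
  · rintro ⟨u, hu, rfl⟩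
    exact hc.umbilic u hu

end UmbilicCurve

theorem mainTheorem3 (M : Set UmbilicCurve.E3) (N : UmbilicCurve.E3 → UmbilicCurve.E3)
    (hM : UmbilicCurve.IsOrientedSurface M N)
    (l : ℝ) (c : ℝ → UmbilicCurve.E3) (hc : UmbilicCurve.IsUmbilicCurve M N l c)
    (u₀ : ℝ) (hu₀ : u₀ ∈ Set.Ioo 0 l) :
    (∃ h : ℝ × ℝ → ℝ, UmbilicCurve.IsStripHeight M N c u₀ h) ∧
    ∀ h : ℝ × ℝ → ℝ, UmbilicCurve.IsStripHeight M N c u₀ h →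
      HasFDerivAt
        (fun q : ℝ × ℝ => UmbilicCurve.meanCurvature N (UmbilicCurve.stripChart N c h q))
        (deriv (UmbilicCurve.curvatureAlong N c) u₀ • ContinuousLinearMap.fst ℝ ℝ ℝ +
          (UmbilicCurve.cubicCoeff h u₀ / 2) • ContinuousLinearMap.snd ℝ ℝ ℝ) (u₀, 0) ∧
      (fderiv ℝ
          (fun q : ℝ × ℝ => UmbilicCurve.meanCurvature N (UmbilicCurve.stripChart N c h q))
          (u₀, 0) ≠ 0 →
        ∃ (V : Set UmbilicCurve.E3) (X₁ X₂ : UmbilicCurve.E3 → UmbilicCurve.E3),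
          IsOpen V ∧ c u₀ ∈ V ∧
          (∀ p ∈ M ∩ V, UmbilicCurve.IsUmbilic N p ↔ p ∈ c '' Set.Icc 0 l) ∧
          UmbilicCurve.IsPrincipalPair M N V X₁ X₂ ∧
          (deriv (UmbilicCurve.curvatureAlong N c) u₀ ≠ 0 →
            UmbilicCurve.IsTransversalNear X₁ c u₀ ∧ UmbilicCurve.IsTransversalNear X₂ c u₀) ∧
          (deriv (UmbilicCurve.curvatureAlong N c) u₀ = 0 →
            deriv (deriv (UmbilicCurve.curvatureAlong N c)) u₀ ≠ 0 →
            UmbilicCurve.cubicCoeff h u₀ ≠ 0 →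
            (UmbilicCurve.IsTransversalNear X₁ c u₀ ∧
              UmbilicCurve.LeafHasQuadraticContact M X₂ c u₀) ∨
            (UmbilicCurve.IsTransversalNear X₂ c u₀ ∧
              UmbilicCurve.LeafHasQuadraticContact M X₁ c u₀))) := by
  open UmbilicCurve in
  refine ⟨exists_isStripHeight hM hc hu₀, fun h hh => ?_⟩
  obtain ⟨U, π, V, hqU, hsU, hkU⟩ := hh.exists_isCoord hM hc hu₀
  obtain ⟨U₁, e, f, hU₁, hU₁U, hq₁, hF₁⟩ := hsU.exists_frame hM hc hqU
  have hs₁ := hsU.mono hU₁ hU₁U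
  have hH := hF₁.hasFDerivAt_meanCurvature hs₁ hM hc hq₁
  refine ⟨hH, fun hne => ?_⟩
  obtain ⟨p, r, hp, hr, hent, hax⟩ := hF₁.exists_coefficients hs₁ hM hc hq₁
  obtain ⟨hp0, hr0⟩ := hax.self_of_nhds
  -- At `(u₀,0)` the pair `(p/2, r)` is `(-a/2, k')`, which up to sign and order is the gradient of
  -- the mean curvature.
  have hpr0 : p (u₀, 0) / 2 ≠ 0 ∨ r (u₀, 0) ≠ 0 := by
    by_contra! hcon
    rw [hp0, hr0] at hcon
    have h1 : cubicCoeff h u₀ / 2 = 0 := by linarith [hcon.1]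
    rw [hH.fderiv, hcon.2, h1] at hne
    simp at hne
  obtain ⟨U₂, R, x, y, hU₂, hq₂, hx, hy, heig⟩ :=
    exists_smooth_eigenvector (hp.div_const 2) hr hpr0
  obtain ⟨U₃, hU₃, hU₃o, hq₃⟩ := eventually_nhds_iff.1 hent
  have hW : IsOpen (U₁ ∩ (U₂ ∩ U₃)) := hU₁.inter (hU₂.inter hU₃o)
  set W := U₁ ∩ (U₂ ∩ U₃)
  have hqW : (u₀, 0) ∈ W := ⟨hq₁, hq₂, hq₃⟩
  have hs := hs₁.mono hW inter_subset_left
  have hF := hF₁.mono (U' := W) inter_subset_left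
  have hk := hkU.restrict hW (inter_subset_left.trans hU₁U)
  have hx' : ContDiffOn ℝ ∞ x W := hx.mono fun q hq => hq.2.1
  have hy' : ContDiffOn ℝ ∞ y W := hy.mono fun q hq => hq.2.1
  have hent' := fun q (hq : q ∈ W) => hU₃ q hq.2.2
  have heig' := fun q (hq : q ∈ W) => heig q hq.2.1
  -- Eliminates the eigenvalue `R` from the two eigenvector equations.
  have hrel : ∀ q ∈ W, p q * (x q * y q) = r q * (x q ^ 2 - y q ^ 2) := by
    intro q hq
    obtain ⟨-, -, h1, h2⟩ := heig' q hq
    linear_combination y q * h1 - x q * h2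
  have hxy := fun q (hq : q ∈ W) => (heig' q hq).2.1
  refine ⟨V ∩ π ⁻¹' W, fun p => frameField e f x y (π p),
    fun p => frameField e f (fun q => -y q) x (π p), hk.isOpen, ?_,
    hF.isUmbilic_iff hk hs hc hent' (fun q hq => (heig' q hq).1.imp_left fun h1 h2 => h1 (by
      rw [h2, zero_div])), hF.isPrincipalPair hk hs hM hc hx' hy' hent'
      (fun q hq => (heig' q hq).2), fun hk' => ?_, fun hk' hk'' _ => ?_⟩
  · rw [← hs.stripChart_axis hqW]
    exact (hk.mapsTo_chart hqW).2
  · rw [← hr0] at hk'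
    have h1 := hrel _ hqW
    refine ⟨hF.isTransversalNear hk hs hM hc hqW x hy' fun h2 => ?_,
      hF.isTransversalNear hk hs hM hc hqW _ hx' fun h2 => ?_⟩
    · simp only [h2, mul_zero, ne_eq, OfNat.ofNat_ne_zero, not_false_eq_true, zero_pow, sub_zero,
        zero_eq_mul, hk', pow_eq_zero_iff, false_or] at h1
      exact (hxy _ hqW).elim (fun h3 => h3 h1) fun h3 => h3 h2
    · simp only [h2, zero_mul, mul_zero, ne_eq, OfNat.ofNat_ne_zero, not_false_eq_true, zero_pow,
        zero_sub, zero_eq_mul, hk', neg_eq_zero, pow_eq_zero_iff, false_or] at h1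
      exact (hxy _ hqW).elim (fun h3 => h3 h2) fun h3 => h3 h1
  · rw [← hr0] at hk'
    have hp0' : p (u₀, 0) ≠ 0 := fun h1 => hpr0.elim (fun h2 => h2 (by rw [h1, zero_div]))
      fun h2 => h2 hk'
    have hρ : HasDerivAt (fun u => r (u, 0)) (deriv (deriv (curvatureAlong N c)) u₀) u₀ := by
      have h1 := hasDerivAt_slice_fst (hr.differentiable (by simp) (u₀, 0))
      have h2 : (fun u => r (u, 0)) =ᶠ[𝓝 u₀] deriv (curvatureAlong N c) := hax.mono fun u hu => hu.2
      rw [← h2.deriv_eq]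
      exact h1.differentiableAt.hasDerivAt
    have h1 := hrel _ hqW
    rw [hk', zero_mul] at h1
    -- Either `x` or `y` vanishes at `(u₀,0)`. If `x = 0`, the field tangent to `c` is the rotated
    -- one `(-y, x)`, which satisfies the same relation; if `y = 0`, it is `(x, y)` itself.
    rcases mul_eq_zero.1 ((mul_eq_zero.1 h1).resolve_left hp0') with hx0 | hy0
    · refine Or.inl ⟨hF.isTransversalNear hk hs hM hc hqW x hy' fun h2 => ?_,
        hF.leafHasQuadraticContact hk hs hM hc hqW hp hy'.neg hx'
          (fun q hq => (hxy q hq).symm.imp_left neg_ne_zero.2) (fun q hq => ?_) hx0 hk' hρ hk''⟩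
      · exact (hxy _ hqW).elim (fun h3 => h3 hx0) fun h3 => h3 h2
      · linear_combination -hrel q hq
    · exact Or.inr ⟨hF.isTransversalNear hk hs hM hc hqW _ hx'
        ((hxy _ hqW).resolve_right fun h2 => h2 hy0),
        hF.leafHasQuadraticContact hk hs hM hc hqW hp hx' hy' hxy hrel hy0 hk' hρ hk''⟩
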